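/- Let $d\in\mathbb{N}$ and $0<\alpha\le 1$. Let $\mathcal{C}^{1+\alpha}(\mathbb{R}^d;\mathbb{R}^m)$ be the space of bounded continuously differentiable functions with bounded, $\alpha$-Hölder continuous derivative, normed by $\|f\|=\sup|f|+\sup|\nabla f|+|\nabla f|_\alpha$, where $|\cdot|_\alpha$ is the Hölder seminorm. Let $\mathcal{M}(\mathbb{R}^d)$ be the space of bounded signed Radon measures, identified with a subspace of $(\mathcal{C}^{1+\alpha}(\mathbb{R}^d))^*$ through $f\mapsto\int f\,d\nu$, and let $\mathcal{Z}$ be the closure of $\mathcal{M}(\mathbb{R}^d)$ in $(\mathcal{C}^{1+\alpha}(\mathbb{R}^d))^*$, with the dual norm. For a weight $\omega:[0,\infty)\to(0,\infty)$ let $\mathcal{C}_\omega([0,\infty);\mathcal{Z})$ be the space of continuous $f:[0,\infty)\to\mathcal{Z}$ with $\|f\|_{\mathcal{Z}_\omega}:=\sup_{t\ge 0}\omega(t)\|f(t)\|_{\mathcal{Z}}<\infty$. Given $b:[0,\infty)\times\mathbb{R}^d\to\mathbb{R}^d$, $w:[0,\infty)\times\mathbb{R}^d\to\mathbb{R}$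 and $\nu_0\in\mathcal{M}(\mathbb{R}^d)$, a weak solution of $$\partial_t\nu_t+\operatorname{div}_x\big(b(t,x)\,\nu_t\big)=w(t,x)\,\nu_t,\qquad \nu_{t=0}=\nu_0,$$ is a curve $\nu_\bullet:[0,\infty)\to\mathcal{M}(\mathbb{R}^d)$ that is narrowly continuous ($t\mapsto\int f\,d\nu_t$ is continuous for every bounded continuous $f$) and satisfies $$\int_0^\infty\!\!\int_{\mathbb{R}^d}\big(\partial_t\varphi(t,x)+b(t,x)\cdot\nabla_x\varphi(t,x)\big)\,d\nu_t(x)\,dt+\int_{\mathbb{R}^d}\varphi(0,x)\,d\nu_0(x)=-\int_0^\infty\!\!\int_{\mathbb{R}^d}w(t,x)\,\varphi(t,x)\,d\nu_t(x)\,dt$$ for all $\varphi\in\mathcal{C}_c^\infty([0,\infty)\times\mathbb{R}^d)$. **Theorem.** Let $t\mapsto b_i(t,\cdot)\in\mathcal{C}_b([0,\infty);\mathcal{C}^{1+\alpha}(\mathbb{R}^d;\mathbb{R}^d))$ and $t\mapsto w_i(t,\cdot)\in\mathcal{C}_b([0,\infty);\mathcal{C}^{1+\alpha}(\mathbb{R}^d;\mathbb{R}))$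 for $i=0,1$. There is a constant $g>0$, depending only on $d,\alpha,b_0,b_1,w_0,w_1$, such that the following holds for every weight $\widehat\omega:[0,\infty)\to(0,\infty)$ that is bounded on bounded sets and satisfies $\widehat\omega(t)=O\big(\tfrac1t e^{-gt}\big)$ as $t\to\infty$ (for example $\widehat\omega(t)=e^{-gt}/(1+t)$). Let $\nu_0\in\mathcal{M}(\mathbb{R}^d)$ and, for each $h\in(-\tfrac12,\tfrac12)$, let $\nu^h_\bullet$ be the weak solution with initial value $\nu_0$ and coefficients $b^h=b_0+h\,b_1$, $w^h=w_0+h\,w_1$. Then $$\big(h\mapsto\nu^h_\bullet\big)\in\mathcal{C}^1\Big((-\tfrac12,\tfrac12);\ \mathcal{C}_{\widehat\omega}([0,\infty);\mathcal{Z})\Big).$$ -/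

import Mathlib

open MeasureTheory Set Filter Topology
open scoped NNReal BoundedContinuousFunction

noncomputable section

namespace TransportMeasures

/-! ### The Hölder space `C^{1+α}` -/

section Holder

/-- Membership in `C^{1+α}(E; F)`: the function is continuously differentiable, the function and
its derivative are bounded, and the derivative is Hölder continuous with exponent `α`. -/
structure IsHolderC1 (α : ℝ≥0) {E F : Type*} [NormedAddCommGroup E] [NormedSpace ℝ E]
    [NormedAddCommGroup F] [NormedSpace ℝ F] (f : E → F) : Prop where
  contDiff : ContDiff ℝ 1 f
  bdd : BddAbove (range fun x => ‖f x‖)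
  bdd_fderiv : BddAbove (range fun x => ‖fderiv ℝ f x‖)
  holder_fderiv : MemHolder α (fderiv ℝ f)

/-- The norm `sup |f| + sup |∇f| + |∇f|_α`. -/
def holderC1Norm (α : ℝ≥0) {E F : Type*} [NormedAddCommGroup E] [NormedSpace ℝ E]
    [NormedAddCommGroup F] [NormedSpace ℝ F] (f : E → F) : ℝ :=
  (⨆ x, ‖f x‖) + (⨆ x, ‖fderiv ℝ f x‖) + nnHolderNorm α (fderiv ℝ f)

variable {α : ℝ≥0} {E F : Type*} [NormedAddCommGroup E] [NormedSpace ℝ E]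
  [NormedAddCommGroup F] [NormedSpace ℝ F] {f g : E → F}

lemma bddAbove_norm_add {ι G : Type*} [NormedAddCommGroup G] {u v : ι → G}
    (hu : BddAbove (range fun i => ‖u i‖)) (hv : BddAbove (range fun i => ‖v i‖)) :
    BddAbove (range fun i => ‖u i + v i‖) := by
  obtain ⟨A, hA⟩ := hu
  obtain ⟨B, hB⟩ := hv
  refine ⟨A + B, ?_⟩
  rintro _ ⟨i, rfl⟩
  exact (norm_add_le _ _).trans (add_le_add (hA ⟨i, rfl⟩) (hB ⟨i, rfl⟩))

lemma bddAbove_norm_smul {ι G : Type*} [NormedAddCommGroup G] [NormedSpace ℝ G] {u : ι → G}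
    (c : ℝ) (hu : BddAbove (range fun i => ‖u i‖)) :
    BddAbove (range fun i => ‖c • u i‖) := by
  obtain ⟨A, hA⟩ := hu
  refine ⟨‖c‖ * A, ?_⟩
  rintro _ ⟨i, rfl⟩
  simp only [norm_smul]
  exact mul_le_mul_of_nonneg_left (hA ⟨i, rfl⟩) (norm_nonneg c)

lemma iSup_norm_add_le {ι G : Type*} [Nonempty ι] [NormedAddCommGroup G] {u v : ι → G}
    (hu : BddAbove (range fun i => ‖u i‖)) (hv : BddAbove (range fun i => ‖v i‖)) :
    (⨆ i, ‖u i + v i‖) ≤ (⨆ i, ‖u i‖) + ⨆ i, ‖v i‖ :=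
  ciSup_le fun i => (norm_add_le _ _).trans (add_le_add (le_ciSup hu i) (le_ciSup hv i))

lemma fderiv_add_fun (hf : IsHolderC1 α f) (hg : IsHolderC1 α g) :
    fderiv ℝ (f + g) = fderiv ℝ f + fderiv ℝ g := by
  funext x
  exact fderiv_add (hf.contDiff.differentiable one_ne_zero x)
    (hg.contDiff.differentiable one_ne_zero x)

lemma fderiv_smul_fun (c : ℝ) (hf : IsHolderC1 α f) :
    fderiv ℝ (c • f) = c • fderiv ℝ f := by
  funext x
  exact fderiv_const_smul (hf.contDiff.differentiable one_ne_zero x) c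

lemma isHolderC1_zero : IsHolderC1 α (0 : E → F) := by
  have h0 : fderiv ℝ (0 : E → F) = 0 := by
    funext x
    simp
  refine ⟨contDiff_const, ⟨0, ?_⟩, ⟨0, ?_⟩, ?_⟩
  · rintro _ ⟨x, rfl⟩
    simp
  · rintro _ ⟨x, rfl⟩
    simp [h0]
  · rw [h0]
    exact memHolder_zero

lemma IsHolderC1.add (hf : IsHolderC1 α f) (hg : IsHolderC1 α g) : IsHolderC1 α (f + g) := by
  refine ⟨hf.contDiff.add hg.contDiff, bddAbove_norm_add hf.bdd hg.bdd, ?_, ?_⟩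
  · rw [fderiv_add_fun hf hg]
    exact bddAbove_norm_add hf.bdd_fderiv hg.bdd_fderiv
  · rw [fderiv_add_fun hf hg]
    exact hf.holder_fderiv.add hg.holder_fderiv

lemma IsHolderC1.smul (c : ℝ) (hf : IsHolderC1 α f) : IsHolderC1 α (c • f) := by
  refine ⟨contDiff_const.smul hf.contDiff, bddAbove_norm_smul c hf.bdd, ?_, ?_⟩
  · rw [fderiv_smul_fun c hf]
    exact bddAbove_norm_smul c hf.bdd_fderiv
  · rw [fderiv_smul_fun c hf]
    exact hf.holder_fderiv.smul

lemma holderC1Norm_add_le (hf : IsHolderC1 α f) (hg : IsHolderC1 α g) :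
    holderC1Norm α (f + g) ≤ holderC1Norm α f + holderC1Norm α g := by
  have h1 : (⨆ x, ‖(f + g) x‖) ≤ (⨆ x, ‖f x‖) + ⨆ x, ‖g x‖ := iSup_norm_add_le hf.bdd hg.bdd
  have h2 : (⨆ x, ‖(fderiv ℝ f + fderiv ℝ g) x‖)
      ≤ (⨆ x, ‖fderiv ℝ f x‖) + ⨆ x, ‖fderiv ℝ g x‖ :=
    iSup_norm_add_le hf.bdd_fderiv hg.bdd_fderiv
  have h3 : (nnHolderNorm α (fderiv ℝ f + fderiv ℝ g) : ℝ)
      ≤ nnHolderNorm α (fderiv ℝ f) + nnHolderNorm α (fderiv ℝ g) := by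
    exact_mod_cast hf.holder_fderiv.nnHolderNorm_add_le hg.holder_fderiv
  unfold holderC1Norm
  rw [fderiv_add_fun hf hg]
  linarith

lemma holderC1Norm_smul (c : ℝ) (hf : IsHolderC1 α f) :
    holderC1Norm α (c • f) = ‖c‖ * holderC1Norm α f := by
  unfold holderC1Norm
  rw [fderiv_smul_fun c hf, hf.holder_fderiv.nnHolderNorm_smul c]
  simp only [Pi.smul_apply, norm_smul, NNReal.coe_mul, coe_nnnorm,
    Real.mul_iSup_of_nonneg (norm_nonneg c), mul_add]

lemma norm_apply_le_holderC1Norm (hf : IsHolderC1 α f) (x : E) : ‖f x‖ ≤ holderC1Norm α f := by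
  have h1 : ‖f x‖ ≤ ⨆ x, ‖f x‖ := le_ciSup hf.bdd x
  have h2 : 0 ≤ ⨆ x, ‖fderiv ℝ f x‖ := Real.iSup_nonneg fun _ => norm_nonneg _
  have h3 : (0 : ℝ) ≤ nnHolderNorm α (fderiv ℝ f) := NNReal.coe_nonneg _
  unfold holderC1Norm
  linarith

/-- `C^{1+α}(E; F)` as a linear subspace of the space of all functions. -/
def holderC1Submodule (α : ℝ≥0) (E F : Type*) [NormedAddCommGroup E] [NormedSpace ℝ E]
    [NormedAddCommGroup F] [NormedSpace ℝ F] : Submodule ℝ (E → F) where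
  carrier := {f | IsHolderC1 α f}
  add_mem' hf hg := hf.add hg
  zero_mem' := isHolderC1_zero
  smul_mem' c _ hf := hf.smul c

/-- The Hölder space `C^{1+α}(E; F)`, normed by `sup |f| + sup |∇f| + |∇f|_α`. -/
def HolderC1 (α : ℝ≥0) (E F : Type*) [NormedAddCommGroup E] [NormedSpace ℝ E]
    [NormedAddCommGroup F] [NormedSpace ℝ F] : Type _ :=
  ↥(holderC1Submodule α E F)

namespace HolderC1

instance : CoeFun (HolderC1 α E F) (fun _ => E → F) := ⟨fun f => f.1⟩

instance : AddCommGroup (HolderC1 α E F) :=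
  inferInstanceAs (AddCommGroup ↥(holderC1Submodule α E F))

instance : Module ℝ (HolderC1 α E F) :=
  inferInstanceAs (Module ℝ ↥(holderC1Submodule α E F))

lemma isHolderC1 (f : HolderC1 α E F) : IsHolderC1 α (f : E → F) := f.2

lemma coe_zero : ((0 : HolderC1 α E F) : E → F) = 0 := rfl

lemma coe_add (f g : HolderC1 α E F) : ((f + g : HolderC1 α E F) : E → F) = ⇑f + ⇑g := rfl

lemma coe_smul (c : ℝ) (f : HolderC1 α E F) : ((c • f : HolderC1 α E F) : E → F) = c • ⇑f := rfl

lemma coe_neg (f : HolderC1 α E F) : ((-f : HolderC1 α E F) : E → F) = (-1 : ℝ) • ⇑f := by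
  rw [neg_one_smul]
  rfl

instance : NormedAddCommGroup (HolderC1 α E F) :=
  AddGroupNorm.toNormedAddCommGroup
    { toFun := fun f => holderC1Norm α (f : E → F)
      map_zero' := by
        have h := holderC1Norm_smul (0 : ℝ) (isHolderC1_zero (α := α) (E := E) (F := F))
        rw [zero_smul, norm_zero, zero_mul] at h
        exact h
      add_le' := fun f g => holderC1Norm_add_le f.isHolderC1 g.isHolderC1
      neg' := fun f => by
        rw [coe_neg, holderC1Norm_smul (-1) f.isHolderC1]
        simp
      eq_zero_of_map_eq_zero' := fun f hf => by
        apply Subtype.ext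
        funext x
        have h := norm_apply_le_holderC1Norm f.isHolderC1 x
        have h' : holderC1Norm α (f : E → F) = 0 := hf
        rw [h'] at h
        exact norm_le_zero_iff.mp h }

lemma norm_def (f : HolderC1 α E F) : ‖f‖ = holderC1Norm α (f : E → F) := rfl

instance : NormedSpace ℝ (HolderC1 α E F) where
  norm_smul_le c f := (holderC1Norm_smul c f.isHolderC1).le

lemma norm_apply_le (f : HolderC1 α E F) (x : E) : ‖f x‖ ≤ ‖f‖ :=
  norm_apply_le_holderC1Norm f.isHolderC1 x

end HolderC1

end Holder

/-! ### Bounded signed measures as functionals, and the space `Z` -/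

section SpaceZ

/-- `ℝ^d` with its Euclidean norm. -/
abbrev Rn (d : ℕ) : Type := EuclideanSpace ℝ (Fin d)

variable {d : ℕ} {α : ℝ≥0}

lemma isFiniteMeasure_variation (ν : SignedMeasure (Rn d)) : IsFiniteMeasure ν.variation := by
  rw [← SignedMeasure.totalVariation_eq_variation]
  infer_instance

lemma integrable_holderC1 (ν : SignedMeasure (Rn d)) (f : HolderC1 α (Rn d) ℝ) :
    ν.Integrable (f : Rn d → ℝ) := by
  have := isFiniteMeasure_variation ν
  exact Integrable.of_bound (f.isHolderC1.contDiff.continuous.aestronglyMeasurable) ‖f‖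
    (Eventually.of_forall f.norm_apply_le)

/-- The functional `f ↦ ∫ f dν` on `C^{1+α}(ℝ^d)` defined by a bounded signed measure `ν`. -/
def measureFunctional (α : ℝ≥0) (ν : SignedMeasure (Rn d)) :
    StrongDual ℝ (HolderC1 α (Rn d) ℝ) :=
  LinearMap.mkContinuous
    { toFun := fun f => ∫ᵛ x, f x ∂<•ν
      map_add' := fun f g =>
        VectorMeasure.integral_fun_add (μ := ν) (integrable_holderC1 ν f) (integrable_holderC1 ν g)
      map_smul' := fun c f => VectorMeasure.integral_fun_smul ν _ c (f : Rn d → ℝ) }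
    (‖(ContinuousLinearMap.lsmul ℝ ℝ : ℝ →L[ℝ] ℝ →L[ℝ] ℝ).flip‖ * ν.variation.real univ)
    (fun f => by
      have := isFiniteMeasure_variation ν
      have h := VectorMeasure.norm_integral_le_of_norm_le_const (μ := ν)
        (B := (ContinuousLinearMap.lsmul ℝ ℝ : ℝ →L[ℝ] ℝ →L[ℝ] ℝ).flip)
        (Eventually.of_forall f.norm_apply_le)
      refine h.trans (le_of_eq ?_)
      ring)

lemma measureFunctional_apply (ν : SignedMeasure (Rn d)) (f : HolderC1 α (Rn d) ℝ) :
    measureFunctional α ν f = ∫ᵛ x, f x ∂<•ν := rfl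

/-- The identification of `M(ℝ^d)` with a linear subspace of `(C^{1+α}(ℝ^d))^*`. -/
def measureToDual (d : ℕ) (α : ℝ≥0) :
    SignedMeasure (Rn d) →ₗ[ℝ] StrongDual ℝ (HolderC1 α (Rn d) ℝ) where
  toFun ν := measureFunctional α ν
  map_add' μ ν := by
    ext f
    change measureFunctional α (μ + ν) f = measureFunctional α μ f + measureFunctional α ν f
    simp only [measureFunctional_apply]
    exact VectorMeasure.integral_add_vectorMeasure (integrable_holderC1 μ f)
      (integrable_holderC1 ν f)
  map_smul' c ν := by
    ext f
    change measureFunctional α (c • ν) f = c • measureFunctional α ν f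
    simp only [measureFunctional_apply]
    exact VectorMeasure.integral_smul_vectorMeasure (f : Rn d → ℝ) c

/-- The space `Z`: the closure of `M(ℝ^d)` in `(C^{1+α}(ℝ^d))^*`, with the dual norm. -/
abbrev SpaceZ (d : ℕ) (α : ℝ≥0) : Submodule ℝ (StrongDual ℝ (HolderC1 α (Rn d) ℝ)) :=
  (measureToDual d α).range.topologicalClosure

/-- A bounded signed measure as an element of `Z`. -/
def measureToZ (α : ℝ≥0) (ν : SignedMeasure (Rn d)) : SpaceZ d α :=
  ⟨measureToDual d α ν, Submodule.le_topologicalClosure _ ⟨ν, rfl⟩⟩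

end SpaceZ

/-! ### The weighted space `C_ω([0,∞); X)` -/

section Weighted

/-- A weight: a positive function on `[0,∞)`. -/
structure Weight where
  toFun : ℝ≥0 → ℝ
  pos : ∀ t, 0 < toFun t

instance : CoeFun Weight (fun _ => ℝ≥0 → ℝ) := ⟨Weight.toFun⟩

variable {ω : Weight} {X : Type*} [NormedAddCommGroup X] [NormedSpace ℝ X]

lemma norm_weight_smul (t : ℝ≥0) (x : X) : ‖ω t • x‖ = ω t * ‖x‖ := by
  rw [norm_smul, Real.norm_of_nonneg (ω.pos t).le]

/-- The continuous functions `f : [0,∞) → X` with `sup_t ω(t) ‖f(t)‖ < ∞`, as a linear subspace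
of the space of all functions. -/
def weightedSubmodule (ω : Weight) (X : Type*) [NormedAddCommGroup X] [NormedSpace ℝ X] :
    Submodule ℝ (ℝ≥0 → X) where
  carrier := {f | Continuous f ∧ BddAbove (range fun t => ω t * ‖f t‖)}
  add_mem' := by
    rintro f g ⟨hf, hf'⟩ ⟨hg, hg'⟩
    refine ⟨hf.add hg, ?_⟩
    simp only [← norm_weight_smul, Pi.add_apply, smul_add] at hf' hg' ⊢
    exact bddAbove_norm_add hf' hg'
  zero_mem' := by
    refine ⟨continuous_const, ⟨0, ?_⟩⟩
    rintro _ ⟨t, rfl⟩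
    simp
  smul_mem' := by
    rintro c f ⟨hf, hf'⟩
    refine ⟨hf.const_smul c, ?_⟩
    simp only [← norm_weight_smul, Pi.smul_apply, smul_comm _ c] at hf' ⊢
    exact bddAbove_norm_smul c hf'

/-- The space `C_ω([0,∞); X)`, normed by `sup_t ω(t) ‖f(t)‖`. -/
def WeightedC (ω : Weight) (X : Type*) [NormedAddCommGroup X] [NormedSpace ℝ X] : Type _ :=
  ↥(weightedSubmodule ω X)

namespace WeightedC

instance : CoeFun (WeightedC ω X) (fun _ => ℝ≥0 → X) := ⟨fun f => f.1⟩

instance : AddCommGroup (WeightedC ω X) :=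
  inferInstanceAs (AddCommGroup ↥(weightedSubmodule ω X))

instance : Module ℝ (WeightedC ω X) :=
  inferInstanceAs (Module ℝ ↥(weightedSubmodule ω X))

lemma continuous_coe (f : WeightedC ω X) : Continuous (f : ℝ≥0 → X) := f.2.1

lemma bddAbove (f : WeightedC ω X) : BddAbove (range fun t => ω t * ‖f t‖) := f.2.2

lemma coe_add (f g : WeightedC ω X) : ((f + g : WeightedC ω X) : ℝ≥0 → X) = ⇑f + ⇑g := rfl

lemma coe_neg (f : WeightedC ω X) : ((-f : WeightedC ω X) : ℝ≥0 → X) = -⇑f := rfl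

lemma coe_smul (c : ℝ) (f : WeightedC ω X) : ((c • f : WeightedC ω X) : ℝ≥0 → X) = c • ⇑f := rfl

instance : NormedAddCommGroup (WeightedC ω X) :=
  AddGroupNorm.toNormedAddCommGroup
    { toFun := fun f => ⨆ t, ω t * ‖f t‖
      map_zero' := by
        have h : ∀ t, (0 : WeightedC ω X) t = 0 := fun _ => rfl
        simp [h]
      add_le' := fun f g => by
        have hf := f.bddAbove
        have hg := g.bddAbove
        simp only [coe_add, ← norm_weight_smul, Pi.add_apply, smul_add] at hf hg ⊢
        exact iSup_norm_add_le hf hg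
      neg' := fun f => by simp [coe_neg]
      eq_zero_of_map_eq_zero' := fun f hf => by
        apply Subtype.ext
        funext t
        have h : ω t * ‖f t‖ ≤ ⨆ t, ω t * ‖f t‖ := le_ciSup f.bddAbove t
        have h' : (⨆ t, ω t * ‖f t‖) = 0 := hf
        rw [h'] at h
        have h'' : ‖f t‖ ≤ 0 := by
          by_contra hc
          exact absurd h (not_le.mpr (mul_pos (ω.pos t) (not_le.mp hc)))
        exact norm_le_zero_iff.mp h'' }

lemma norm_def (f : WeightedC ω X) : ‖f‖ = ⨆ t, ω t * ‖f t‖ := rfl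

instance : NormedSpace ℝ (WeightedC ω X) where
  norm_smul_le c f := by
    have h : ∀ t, ω t * ‖(c • f : WeightedC ω X) t‖ = ‖c‖ * (ω t * ‖f t‖) := fun t => by
      rw [coe_smul, Pi.smul_apply, norm_smul]
      ring
    simp only [norm_def, h]
    rw [Real.mul_iSup_of_nonneg (norm_nonneg c)]

end WeightedC

end Weighted

/-! ### Weak solutions of the linear transport equation -/

section Transport

variable {d : ℕ}

/-- Narrow continuity of a curve of bounded signed measures: `t ↦ ∫ f dν_t` is continuous for
every bounded continuous `f`. -/
def NarrowlyContinuous (ν : ℝ≥0 → SignedMeasure (Rn d)) : Prop :=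
  ∀ f : Rn d →ᵇ ℝ, Continuous fun t => ∫ᵛ x, f x ∂<•(ν t)

/-- `ν` is a weak solution of `∂_t ν_t + div_x (b(t,x) ν_t) = w(t,x) ν_t`, `ν_{t=0} = ν₀`, that is,
it is narrowly continuous and
`∫_0^∞ ∫ (∂_t φ + b · ∇_x φ) dν_t dt + ∫ φ(0,·) dν₀ = - ∫_0^∞ ∫ w φ dν_t dt`
for all test functions `φ ∈ C_c^∞([0,∞) × ℝ^d)`. The test functions are the restrictions to
`[0,∞) × ℝ^d` of smooth functions with compact support on `ℝ × ℝ^d`. -/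
structure IsWeakSolution (b : ℝ≥0 → Rn d → Rn d) (w : ℝ≥0 → Rn d → ℝ)
    (ν₀ : SignedMeasure (Rn d)) (ν : ℝ≥0 → SignedMeasure (Rn d)) : Prop where
  narrowlyContinuous : NarrowlyContinuous ν
  weak_eq : ∀ φ : ℝ → Rn d → ℝ,
    ContDiff ℝ (⊤ : ℕ∞) (Function.uncurry φ) → HasCompactSupport (Function.uncurry φ) →
    (∫ t in Ioi (0 : ℝ), ∫ᵛ x,
          (deriv (fun s => φ s x) t + inner ℝ (b t.toNNReal x) (gradient (φ t) x))
            ∂<•(ν t.toNNReal))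
        + ∫ᵛ x, φ 0 x ∂<•ν₀
      = - ∫ t in Ioi (0 : ℝ), ∫ᵛ x, w t.toNNReal x * φ t x ∂<•(ν t.toNNReal)

end Transport

end TransportMeasures

end

/-! Formally, `ν_t` is `ν₀` pushed along the flow of `b` and weighted by the exponential of `w`
along trajectories: `∫ f dν_t = ∫ f(X_t) e^{Z_t} dν₀` with `X' = b(t,X)`, `Z' = w(t,X)`, `X_0 = x`,
`Z_0 = 0`. Since `f`, `b`, `w` are of class `C^{1+α}`, the right side is a `C^{1+α}` function of
`h`, with constants proportional to `‖f‖` and growing exponentially in `t`. Taking the supremum over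
`‖f‖ ≤ 1` turns this into a statement in the dual norm.

Neither the flow nor the derivative in `h` is constructed. Differentiability is read off from second
differences: a continuous map from an open interval to a Banach space with `‖F(x+k) + F(x-k) -
2F(x)‖ ≤ C k^{1+α}`, `α > 0`, is `C¹` (`contDiffOn_of_second_difference`). Hence it suffices to
bound the size, the increments in `h` and the second differences in `h` of `∫ f dν^h_t`, each by a
multiple of `‖f‖ e^{gt}`.

The representation formula is replaced by its explicit Euler approximation
(`IsWeakSolution.tendsto_eulerObs`). One Euler step is compared with the weak solution by testing
with the function that carries `f` backwards with coefficients frozen in time; it solves the dual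
equation up to a small residual, and the accumulated residuals vanish with the step size. For the
Euler scheme the dependence on `h` is controlled by discrete Gronwall estimates that do not see the
number of steps (`norm_euler_sub_le`, `norm_euler_second_le`), and `abs_obs_second_le` transfers
them to `f(x) e^z`. The bounds survive the limit of vanishing step size.

After multiplication by `e^{-gt}` the solutions live in the Banach space of bounded continuous
`Z`-valued curves, where the criterion applies; multiplication by `e^{gt}` is a continuous linear
map back into the weighted space (`exists_contDiffOn_weighted`). -/

noncomputable section

namespace TransportMeasures

/-! ### Integration against signed measures and narrowly continuous curves -/

section Pairing

variable {d : ℕ}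

/-- The integral of a real function against a signed measure. -/
def pairing (ν : SignedMeasure (Rn d)) (g : Rn d → ℝ) : ℝ := ∫ᵛ x, g x ∂<•ν

/-- A bound for the integrals of functions bounded by `1`. -/
def massBound (ν : SignedMeasure (Rn d)) : ℝ :=
  ‖(ContinuousLinearMap.lsmul ℝ ℝ : ℝ →L[ℝ] ℝ →L[ℝ] ℝ).flip‖ * ν.variation.real univ

lemma massBound_nonneg (ν : SignedMeasure (Rn d)) : 0 ≤ massBound ν := by
  unfold massBound
  positivity

lemma integrable_of_bounded (ν : SignedMeasure (Rn d)) {g : Rn d → ℝ} (hg : Continuous g) {C : ℝ}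
    (hC : ∀ x, |g x| ≤ C) : ν.Integrable g := by
  have := isFiniteMeasure_variation ν
  exact Integrable.of_bound hg.aestronglyMeasurable C (Eventually.of_forall hC)

lemma abs_pairing_le (ν : SignedMeasure (Rn d)) {g : Rn d → ℝ} {C : ℝ}
    (hC : ∀ x, |g x| ≤ C) : |pairing ν g| ≤ massBound ν * C := by
  have := isFiniteMeasure_variation ν
  have h := VectorMeasure.norm_integral_le_of_norm_le_const (μ := ν)
    (B := (ContinuousLinearMap.lsmul ℝ ℝ : ℝ →L[ℝ] ℝ →L[ℝ] ℝ).flip)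
    (Eventually.of_forall hC)
  refine h.trans (le_of_eq ?_)
  unfold massBound
  ring

lemma pairing_add (ν : SignedMeasure (Rn d)) {f g : Rn d → ℝ} (hf : Continuous f)
    (hg : Continuous g) {A B : ℝ} (hA : ∀ x, |f x| ≤ A) (hB : ∀ x, |g x| ≤ B) :
    pairing ν (fun x => f x + g x) = pairing ν f + pairing ν g :=
  VectorMeasure.integral_fun_add (integrable_of_bounded ν hf hA) (integrable_of_bounded ν hg hB)

lemma pairing_sub (ν : SignedMeasure (Rn d)) {f g : Rn d → ℝ} (hf : Continuous f)
    (hg : Continuous g) {A B : ℝ} (hA : ∀ x, |f x| ≤ A) (hB : ∀ x, |g x| ≤ B) :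
    pairing ν (fun x => f x - g x) = pairing ν f - pairing ν g :=
  VectorMeasure.integral_fun_sub (integrable_of_bounded ν hf hA) (integrable_of_bounded ν hg hB)

lemma pairing_const_mul (ν : SignedMeasure (Rn d)) (c : ℝ) (f : Rn d → ℝ) :
    pairing ν (fun x => c * f x) = c * pairing ν f :=
  VectorMeasure.integral_fun_smul ν _ c f

lemma tendsto_pairing (ν : SignedMeasure (Rn d)) {F : ℕ → Rn d → ℝ} {f : Rn d → ℝ} {C : ℝ}
    (hF : ∀ n, Continuous (F n)) (hC : ∀ n x, |F n x| ≤ C)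
    (hlim : ∀ x, Tendsto (fun n => F n x) atTop (𝓝 (f x))) :
    Tendsto (fun n => pairing ν (F n)) atTop (𝓝 (pairing ν f)) := by
  have := isFiniteMeasure_variation ν
  exact VectorMeasure.tendsto_integral_of_dominated_convergence (fun _ => C)
    (fun n => (hF n).aestronglyMeasurable) (integrable_const C)
    (fun n => Eventually.of_forall (hC n)) (Eventually.of_forall hlim)

/-- The functional defined by a signed measure on the bounded continuous functions. -/
def pairingCLM (ν : SignedMeasure (Rn d)) : (Rn d →ᵇ ℝ) →L[ℝ] ℝ :=
  LinearMap.mkContinuous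
    { toFun := fun f => pairing ν f
      map_add' := fun f g => pairing_add ν f.continuous g.continuous f.norm_coe_le_norm
        g.norm_coe_le_norm
      map_smul' := fun c f => pairing_const_mul ν c f }
    (massBound ν) (fun f => abs_pairing_le ν f.norm_coe_le_norm)

/-- Uniform boundedness of a narrowly continuous curve on a bounded time interval. -/
lemma NarrowlyContinuous.exists_bound {ν : ℝ≥0 → SignedMeasure (Rn d)}
    (hν : NarrowlyContinuous ν) (T : ℝ≥0) :
    ∃ M : ℝ, 0 ≤ M ∧ ∀ t ≤ T, ∀ g : Rn d → ℝ, Continuous g → ∀ C : ℝ, (∀ x, |g x| ≤ C) →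
      |pairing (ν t) g| ≤ M * C := by
  -- For fixed `f`, narrow continuity bounds `t ↦ ∫ f dν_t` on the compact interval `[0,T]`; the
  -- uniform boundedness principle makes the bound uniform in `f`.
  obtain ⟨M, hM⟩ := banach_steinhaus (g := fun t : Set.Iic T => pairingCLM (ν t)) (fun f => by
    obtain ⟨C, hC⟩ := (isCompact_Icc (a := (0 : ℝ≥0)) (b := T)).exists_bound_of_continuousOn
      (hν f).continuousOn
    exact ⟨C, fun t => hC t ⟨zero_le, t.2⟩⟩)
  refine ⟨max M 0, le_max_right _ _, fun t ht g hg C hC => ?_⟩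
  have hC0 : 0 ≤ C := (abs_nonneg _).trans (hC 0)
  let G : Rn d →ᵇ ℝ := BoundedContinuousFunction.ofNormedAddCommGroup g hg C hC
  have h1 : ‖pairingCLM (ν t) G‖ ≤ ‖pairingCLM (ν t)‖ * ‖G‖ := ContinuousLinearMap.le_opNorm _ _
  refine h1.trans ?_
  have h2 : ‖pairingCLM (ν t)‖ ≤ max M 0 := (hM ⟨t, ht⟩).trans (le_max_left _ _)
  have h3 : ‖G‖ ≤ C := BoundedContinuousFunction.norm_ofNormedAddCommGroup_le _ hC0 _
  exact mul_le_mul h2 h3 (norm_nonneg _) (le_max_right _ _)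

lemma exists_bound_of_hasCompactSupport {X : Type*} [TopologicalSpace X] {g : X → ℝ}
    (hg : Continuous g) (hc : HasCompactSupport g) : ∃ C, 0 ≤ C ∧ ∀ x, |g x| ≤ C := by
  obtain ⟨C, hC⟩ := hg.bounded_above_of_compact_support hc
  exact ⟨max C 0, le_max_right _ _, fun x => (hC x).trans (le_max_left _ _)⟩

/-- Pairing a narrowly continuous curve with the time slices of a compactly supported function. -/
lemma NarrowlyContinuous.continuous_pairing {ν : ℝ≥0 → SignedMeasure (Rn d)}
    (hν : NarrowlyContinuous ν) {g : ℝ × Rn d → ℝ} (hg : Continuous g)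
    (hc : HasCompactSupport g) :
    Continuous fun t : ℝ => pairing (ν t.toNNReal) (fun x => g (t, x)) := by
  obtain ⟨C, hC0, hC⟩ := exists_bound_of_hasCompactSupport hg hc
  have huc : UniformContinuous g := hc.uniformContinuous_of_continuous hg
  rw [Metric.uniformContinuous_iff] at huc
  rw [continuous_iff_continuousAt]
  intro t
  -- The increment is split in two: the change of the slice, small by uniform continuity of `g` and
  -- the mass bound `M` on `[0,t+1]`, and the change of the measure against the fixed slice at `t`.
  -- The radius is capped at 1 to stay within reach of `M`.
  obtain ⟨M, hM0, hM⟩ := hν.exists_bound (t + 1).toNNReal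
  have hslice : ∀ s, Continuous fun x => g (s, x) := fun s => by fun_prop
  let G : Rn d →ᵇ ℝ := BoundedContinuousFunction.ofNormedAddCommGroup (fun x => g (t, x))
    (hslice t) C (fun x => hC _)
  have h1 : ContinuousAt (fun s : ℝ => pairing (ν s.toNNReal) (fun x => g (t, x))) t :=
    ((hν G).comp continuous_real_toNNReal).continuousAt
  rw [Metric.continuousAt_iff] at h1 ⊢
  intro ε hε
  obtain ⟨δ₁, hδ₁, h1⟩ := h1 (ε / 2) (by positivity)
  obtain ⟨δ₂, hδ₂, h2⟩ := huc (ε / 2 / (M + 1)) (by positivity)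
  refine ⟨min (min δ₁ δ₂) 1, by positivity, fun {s} hs => ?_⟩
  have hs1 : dist s t < δ₁ := hs.trans_le ((min_le_left _ _).trans (min_le_left _ _))
  have hs2 : dist s t < δ₂ := hs.trans_le ((min_le_left _ _).trans (min_le_right _ _))
  have hs3 : dist s t < 1 := hs.trans_le (min_le_right _ _)
  have h3 : |pairing (ν s.toNNReal) (fun x => g (s, x) - g (t, x))| ≤ M * (ε / 2 / (M + 1)) := by
    refine hM _ (Real.toNNReal_le_toNNReal ?_) _ ((hslice s).sub (hslice t)) _ fun x => ?_
    · rw [Real.dist_eq] at hs3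
      linarith [(abs_lt.mp hs3).2]
    · refine (h2 ?_).le
      rw [Prod.dist_eq, dist_self, max_eq_left dist_nonneg]
      exact hs2
  have h4 : M * (ε / 2 / (M + 1)) ≤ ε / 2 := by
    rw [mul_div_assoc', div_le_iff₀ (by positivity)]
    nlinarith
  rw [pairing_sub _ (hslice s) (hslice t) (fun x => hC _) (fun x => hC _)] at h3
  have h5 := h1 hs1
  rw [Real.dist_eq] at h5 ⊢
  rw [abs_le] at h3
  rw [abs_lt] at h5 ⊢
  constructor <;> linarith

end Pairing

/-! ### Smooth approximation of test functions -/

section Mollification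

variable {E : Type*} [NormedAddCommGroup E] [NormedSpace ℝ E] [FiniteDimensional ℝ E]
  [MeasurableSpace E] [BorelSpace E]

/-- A compactly supported `C¹` function is a limit of smooth functions, in the `C¹` norm and with
supports in a fixed compact set. -/
lemma exists_smooth_approx {φ : E → ℝ} (hφ : ContDiff ℝ 1 φ) (hc : HasCompactSupport φ) :
    ∃ S : Set E, IsCompact S ∧ (∀ x ∉ S, φ x = 0) ∧ ∀ ε > 0, ∃ φ' : E → ℝ,
      ContDiff ℝ (⊤ : ℕ∞) φ' ∧ (∀ x ∉ S, φ' x = 0) ∧ (∀ x, |φ' x - φ x| ≤ ε) ∧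
        ∀ x, ‖fderiv ℝ φ' x - fderiv ℝ φ x‖ ≤ ε := by
  have : ProperSpace E := FiniteDimensional.proper_rclike ℝ E
  -- The mollification radius `δ` below is at most 1, so one compact set contains the supports of
  -- all approximations.
  refine ⟨Metric.cthickening 1 (tsupport φ), hc.isCompact.cthickening, fun x hx => ?_,
    fun ε hε => ?_⟩
  · by_contra h
    exact hx (Metric.self_subset_cthickening _ (subset_tsupport φ h))
  have hd : Continuous (fderiv ℝ φ) := hφ.continuous_fderiv one_ne_zero
  have h1 := hc.uniformContinuous_of_continuous hφ.continuous
  have h2 := (hc.fderiv ℝ).uniformContinuous_of_continuous hd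
  rw [Metric.uniformContinuous_iff] at h1 h2
  obtain ⟨δ₁, hδ₁, h1⟩ := h1 ε hε
  obtain ⟨δ₂, hδ₂, h2⟩ := h2 ε hε
  set δ := min (min δ₁ δ₂) 1 with hδ
  have hδ0 : 0 < δ := by positivity
  let χ : ContDiffBump (0 : E) := ⟨δ / 2, δ, by positivity, by linarith⟩
  let μ : Measure E := Measure.addHaar
  let φ' : E → ℝ := convolution (χ.normed μ) φ (ContinuousLinearMap.lsmul ℝ ℝ) μ
  have hloc : LocallyIntegrable (χ.normed μ) μ := χ.continuous_normed.locallyIntegrable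
  refine ⟨φ', ?_, fun x hx => ?_, fun x => ?_, fun x => ?_⟩
  · exact χ.hasCompactSupport_normed.contDiff_convolution_left _ χ.contDiff_normed
      hφ.continuous.locallyIntegrable
  -- Outside the thickening `φ` vanishes on the whole averaging ball, so the convolution estimate
  -- holds with error 0.
  · have hz : ∀ y ∈ Metric.ball x χ.rOut, φ y = 0 := by
      intro y hy
      by_contra h
      refine hx (Metric.mem_cthickening_of_dist_le x y 1 _ (subset_tsupport φ h) ?_)
      rw [Metric.mem_ball, dist_comm] at hy
      exact hy.le.trans (min_le_right _ _)
    have hzx : φ x = 0 := hz x (Metric.mem_ball_self hδ0)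
    have := χ.dist_normed_convolution_le (μ := μ) (g := φ) (x₀ := x) (ε := 0)
      hφ.continuous.aestronglyMeasurable (fun y hy => by rw [hz y hy, hzx, dist_self])
    rw [hzx] at this
    exact dist_le_zero.mp this
  · exact χ.dist_normed_convolution_le (μ := μ) (g := φ) (x₀ := x) (ε := ε)
      hφ.continuous.aestronglyMeasurable (fun y hy => (h1 (lt_of_lt_of_le hy
        ((min_le_left _ _).trans (min_le_left _ _)))).le)
  · have h3 : fderiv ℝ φ' x
        = convolution (χ.normed μ) (fderiv ℝ φ) (ContinuousLinearMap.lsmul ℝ ℝ) μ x := by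
      refine (hc.hasFDerivAt_convolution_right (ContinuousLinearMap.lsmul ℝ ℝ) hloc hφ
        x).fderiv.trans ?_
      congr 1
    rw [h3, ← dist_eq_norm]
    exact χ.dist_normed_convolution_le (μ := μ) (g := fderiv ℝ φ) (x₀ := x) (ε := ε)
      hd.aestronglyMeasurable (fun y hy => (h2 (lt_of_lt_of_le hy
        ((min_le_left _ _).trans (min_le_right _ _)))).le)

end Mollification

/-! ### The weak formulation for smooth test functions on space-time -/

section WeakForm

variable {d : ℕ}

lemma pairing_zero (ν : SignedMeasure (Rn d)) : pairing ν (fun _ => 0) = 0 := by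
  simpa using pairing_const_mul ν 0 (fun _ => 0)

lemma hasCompactSupport_pairing (ν : ℝ → SignedMeasure (Rn d)) {g : ℝ × Rn d → ℝ}
    (hc : HasCompactSupport g) : HasCompactSupport fun t => pairing (ν t) (fun x => g (t, x)) := by
  refine HasCompactSupport.intro (hc.isCompact.image continuous_fst) fun t ht => ?_
  have : (fun x => g (t, x)) = fun _ => 0 := by
    funext x
    by_contra h
    exact ht ⟨(t, x), subset_tsupport g h, rfl⟩
  rw [this, pairing_zero]

lemma NarrowlyContinuous.integrable_pairing {ν : ℝ≥0 → SignedMeasure (Rn d)}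
    (hν : NarrowlyContinuous ν) {g : ℝ × Rn d → ℝ} (hg : Continuous g)
    (hc : HasCompactSupport g) :
    Integrable fun t : ℝ => pairing (ν t.toNNReal) (fun x => g (t, x)) := by
  have h1 := hν.continuous_pairing hg hc
  have h2 := hasCompactSupport_pairing (fun t : ℝ => ν t.toNNReal) hc
  generalize (fun t : ℝ => pairing (ν t.toNNReal) (fun x => g (t, x))) = m at h1 h2 ⊢
  exact Continuous.integrable_of_hasCompactSupport h1 h2

/-- The operator `∂_t φ + b · ∇_x φ + w φ`. -/
def transportOp (b : ℝ≥0 → Rn d → Rn d) (w : ℝ≥0 → Rn d → ℝ) (φ : ℝ × Rn d → ℝ)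
    (p : ℝ × Rn d) : ℝ :=
  fderiv ℝ φ p (1, b p.1.toNNReal p.2) + w p.1.toNNReal p.2 * φ p

variable {b : ℝ≥0 → Rn d → Rn d} {w : ℝ≥0 → Rn d → ℝ} {ν₀ : SignedMeasure (Rn d)}
  {ν : ℝ≥0 → SignedMeasure (Rn d)}

lemma continuous_time_ext {F : Type*} [TopologicalSpace F] {c : ℝ≥0 → Rn d → F}
    (hc : Continuous (Function.uncurry c)) :
    Continuous fun p : ℝ × Rn d => c p.1.toNNReal p.2 :=
  hc.comp ((continuous_real_toNNReal.comp continuous_fst).prodMk continuous_snd)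

lemma continuous_fderiv_field (hb : Continuous (Function.uncurry b)) {φ : ℝ × Rn d → ℝ}
    (hφ : ContDiff ℝ 1 φ) :
    Continuous fun p : ℝ × Rn d => fderiv ℝ φ p (1, b p.1.toNNReal p.2) :=
  (hφ.continuous_fderiv one_ne_zero).clm_apply
    (continuous_const.prodMk (continuous_time_ext hb))

lemma continuous_transportOp (hb : Continuous (Function.uncurry b))
    (hw : Continuous (Function.uncurry w)) {φ : ℝ × Rn d → ℝ} (hφ : ContDiff ℝ 1 φ) :
    Continuous (transportOp b w φ) :=
  (continuous_fderiv_field hb hφ).add ((continuous_time_ext hw).mul hφ.continuous)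

lemma hasCompactSupport_fderiv_field {φ : ℝ × Rn d → ℝ} (hc : HasCompactSupport φ) :
    HasCompactSupport fun p : ℝ × Rn d => fderiv ℝ φ p (1, b p.1.toNNReal p.2) :=
  HasCompactSupport.mono (hc.fderiv ℝ) fun p hp h0 => hp (by
    change fderiv ℝ φ p = 0 at h0
    simp [h0])

lemma hasCompactSupport_transportOp {φ : ℝ × Rn d → ℝ} (hc : HasCompactSupport φ) :
    HasCompactSupport (transportOp b w φ) :=
  (hasCompactSupport_fderiv_field hc).add hc.mul_left

/-- Once the time derivative and the gradient are folded into one Fréchet derivative on space-time,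
time and space can be mollified and cut off together. -/
lemma deriv_add_inner_gradient {φ : ℝ × Rn d → ℝ} (hφ : ContDiff ℝ 1 φ) (t : ℝ) (x v : Rn d) :
    deriv (fun s => φ (s, x)) t + inner ℝ v (gradient (fun y => φ (t, y)) x)
      = fderiv ℝ φ (t, x) (1, v) := by
  have h := (hφ.differentiable one_ne_zero (t, x)).hasFDerivAt
  have h1 : HasDerivAt (fun s => φ (s, x)) (fderiv ℝ φ (t, x) (1, 0)) t :=
    h.comp_hasDerivAt t ((hasDerivAt_id t).prodMk (hasDerivAt_const t x))
  have h2 : HasFDerivAt (fun y => φ (t, y))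
      ((fderiv ℝ φ (t, x)).comp (ContinuousLinearMap.inr ℝ ℝ (Rn d))) x :=
    h.comp x (hasFDerivAt_prodMk_right t x)
  rw [h1.deriv, real_inner_comm, gradient, InnerProductSpace.toDual_symm_apply, h2.fderiv]
  rw [ContinuousLinearMap.comp_apply, ContinuousLinearMap.inr_apply, ← map_add]
  simp

lemma IsWeakSolution.weak_eq_smooth (h : IsWeakSolution b w ν₀ ν)
    (hb : Continuous (Function.uncurry b)) (hw : Continuous (Function.uncurry w))
    {φ : ℝ × Rn d → ℝ} (hφ : ContDiff ℝ (⊤ : ℕ∞) φ) (hc : HasCompactSupport φ) :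
    (∫ t in Ioi (0 : ℝ), pairing (ν t.toNNReal) (fun x => transportOp b w φ (t, x)))
      + pairing ν₀ (fun x => φ (0, x)) = 0 := by
  have hφ1 : ContDiff ℝ 1 φ := hφ.of_le (by exact_mod_cast le_top)
  have key := h.weak_eq (fun t x => φ (t, x)) hφ hc
  simp only [deriv_add_inner_gradient hφ1] at key
  have c1 := continuous_fderiv_field hb hφ1
  have c2 : Continuous fun p : ℝ × Rn d => w p.1.toNNReal p.2 * φ p :=
    (continuous_time_ext hw).mul hφ.continuous
  have s1 := hasCompactSupport_fderiv_field (b := b) hc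
  have s2 : HasCompactSupport fun p : ℝ × Rn d => w p.1.toNNReal p.2 * φ p := hc.mul_left
  have i1 := h.narrowlyContinuous.integrable_pairing c1 s1
  have i2 := h.narrowlyContinuous.integrable_pairing c2 s2
  obtain ⟨C1, -, hC1⟩ := exists_bound_of_hasCompactSupport c1 s1
  obtain ⟨C2, -, hC2⟩ := exists_bound_of_hasCompactSupport c2 s2
  have e : ∀ t : ℝ, pairing (ν t.toNNReal) (fun x => transportOp b w φ (t, x))
      = pairing (ν t.toNNReal) (fun x => fderiv ℝ φ (t, x) (1, b t.toNNReal x))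
        + pairing (ν t.toNNReal) (fun x => w t.toNNReal x * φ (t, x)) := fun t =>
    pairing_add _ (c1.comp (Continuous.prodMk_right t)) (c2.comp (Continuous.prodMk_right t))
      (fun x => hC1 (t, x)) (fun x => hC2 (t, x))
  simp only [e]
  rw [integral_add i1.integrableOn i2.integrableOn]
  simp only [pairing]
  linear_combination key

end WeakForm

/-! ### From the weak form to an identity at each time -/

section TimeLocal

/-- The fundamental lemma of the calculus of variations in the form needed for weak solutions. -/
lemma eq_add_integral_of_weak {m n : ℝ → ℝ} (hm : Continuous m) (hn : Continuous n) {m₀ S : ℝ}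
    (hS : 0 < S) (hweak : ∀ θ : ℝ → ℝ, ContDiff ℝ 1 θ →
      (∫ t in (0 : ℝ)..S, (deriv θ t * m t + θ t * n t)) + θ 0 * m₀ = 0) :
    ∀ t ∈ Icc 0 S, m t = m₀ + ∫ s in (0 : ℝ)..t, n s := by
  set N : ℝ → ℝ := fun t => m₀ + ∫ s in (0 : ℝ)..t, n s with hN
  have hNd : ∀ t, HasDerivAt N (n t) t := fun t =>
    (hn.integral_hasStrictDerivAt 0 t).hasDerivAt.const_add m₀
  have hNc : Continuous N := continuous_iff_continuousAt.mpr fun t => (hNd t).continuousAt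
  -- The test function `θ = 1` is admissible because nothing is required of `θ` at the endpoint `S`.
  have hNS : N S = 0 := by
    have := hweak (fun _ => 1) contDiff_const
    simp only [deriv_const, zero_mul, one_mul, zero_add] at this
    simp only [hN]
    linarith
  set D : ℝ → ℝ := fun t => m t - N t with hD
  have hDc : Continuous D := hm.sub hNc
  -- Test with a primitive of `D = m - N`. Integration by parts gives `∫ (θ' N + θ n) = 0`, the
  -- boundary terms vanishing by `N S = 0` and `θ 0 = 0`; subtracting this from the weak identity
  -- leaves `∫ D² = 0`.
  set θ : ℝ → ℝ := fun t => ∫ s in (0 : ℝ)..t, D s with hθ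
  have hθd : ∀ t, HasDerivAt θ (D t) t := fun t => (hDc.integral_hasStrictDerivAt 0 t).hasDerivAt
  have hθ' : deriv θ = D := funext fun t => (hθd t).deriv
  have hθc : Continuous θ := continuous_iff_continuousAt.mpr fun t => (hθd t).continuousAt
  have hθ1 : ContDiff ℝ 1 θ := contDiff_one_iff_deriv.mpr
    ⟨fun t => (hθd t).differentiableAt, hθ' ▸ hDc⟩
  have h1 := hweak θ hθ1
  have hθ0 : θ 0 = 0 := by simp [hθ]
  rw [hθ', hθ0, zero_mul, add_zero] at h1
  have h2 : ∫ t in (0 : ℝ)..S, (D t * N t + θ t * n t) = θ S * N S - θ 0 * N 0 :=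
    intervalIntegral.integral_eq_sub_of_hasDerivAt (fun t _ => (hθd t).mul (hNd t))
      (((hDc.mul hNc).add (hθc.mul hn)).intervalIntegrable _ _)
  rw [hNS, hθ0, mul_zero, zero_mul, sub_zero] at h2
  have h3 : ∫ t in (0 : ℝ)..S, D t ^ 2 = 0 := by
    have i1 : IntervalIntegrable (fun t => D t * m t + θ t * n t) volume 0 S :=
      ((hDc.mul hm).add (hθc.mul hn)).intervalIntegrable 0 S
    have i2 : IntervalIntegrable (fun t => D t * N t + θ t * n t) volume 0 S :=
      ((hDc.mul hNc).add (hθc.mul hn)).intervalIntegrable 0 S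
    have h4 := intervalIntegral.integral_sub i1 i2
    rw [h1, h2, sub_zero] at h4
    rw [← h4]
    congr 1
    funext t
    simp only [hD]
    ring
  intro t ht
  by_contra hne
  have hpos := intervalIntegral.integral_pos hS (f := fun t => D t ^ 2) (hDc.pow 2).continuousOn
    (fun _ _ => sq_nonneg _) ⟨t, ht, by
      have : D t ≠ 0 := sub_ne_zero.mpr hne
      positivity⟩
  exact hpos.ne' h3

end TimeLocal

/-! ### Cutoff functions -/

section Cutoff

variable {E : Type*} [NormedAddCommGroup E] [NormedSpace ℝ E] [FiniteDimensional ℝ E]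

/-- Rescaling one fixed bump by `1/(n+1)` multiplies its gradient by the same factor, so the
commutator of the cutoff with a bounded vector field vanishes in the limit. -/
lemma exists_cutoff : ∃ κ : ℕ → E → ℝ, ∃ C : ℝ, 0 ≤ C ∧ (∀ n, ContDiff ℝ 1 (κ n)) ∧
    (∀ n, HasCompactSupport (κ n)) ∧ (∀ n p, |κ n p| ≤ 1) ∧
    (∀ n p, ‖fderiv ℝ (κ n) p‖ ≤ C * (1 / ((n : ℝ) + 1))) ∧
    ∀ p, Tendsto (fun n => κ n p) atTop (𝓝 1) := by
  have : ProperSpace E := FiniteDimensional.proper_rclike ℝ E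
  let χ : ContDiffBump (0 : E) := ⟨1, 2, one_pos, one_lt_two⟩
  have hχ : ContDiff ℝ 1 χ := χ.contDiff
  obtain ⟨C, hC⟩ := (hχ.continuous_fderiv one_ne_zero).bounded_above_of_compact_support
    (χ.hasCompactSupport.fderiv ℝ)
  have hpos : ∀ n : ℕ, (0 : ℝ) < 1 / ((n : ℝ) + 1) := fun n => by positivity
  refine ⟨fun n p => χ ((1 / ((n : ℝ) + 1)) • p), C, (norm_nonneg _).trans (hC 0),
    fun n => hχ.comp (contDiff_const_smul _), fun n => ?_, fun n p => ?_, fun n p => ?_,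
    fun p => ?_⟩
  · exact χ.hasCompactSupport.comp_homeomorph (Homeomorph.smulOfNeZero _ (hpos n).ne')
  · rw [abs_of_nonneg χ.nonneg]
    exact χ.le_one
  · rw [fderiv_comp_smul, norm_smul, Real.norm_of_nonneg (hpos n).le, mul_comm]
    exact mul_le_mul_of_nonneg_right (hC _) (hpos n).le
  · refine tendsto_const_nhds.congr' ?_
    have h : Tendsto (fun n : ℕ => (1 / ((n : ℝ) + 1)) • p) atTop (𝓝 ((0 : ℝ) • p)) :=
      tendsto_one_div_add_atTop_nhds_zero_nat.smul_const p
    rw [zero_smul] at h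
    filter_upwards [h (Metric.closedBall_mem_nhds 0 one_pos)] with n hn
    exact (χ.one_of_mem_closedBall hn).symm

end Cutoff

/-! ### The weak formulation for `C¹` test functions -/

section WeakFormC1

variable {d : ℕ} {b : ℝ≥0 → Rn d → Rn d} {w : ℝ≥0 → Rn d → ℝ} {ν₀ : SignedMeasure (Rn d)}
  {ν : ℝ≥0 → SignedMeasure (Rn d)}

lemma norm_one_prod_le {K : ℝ} (hK : 0 ≤ K) {v : Rn d} (hv : ‖v‖ ≤ K) :
    ‖((1 : ℝ), v)‖ ≤ 1 + K := by
  rw [norm_prod_le_iff, norm_one]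
  constructor <;> linarith

lemma abs_transportOp_sub_le {K ε : ℝ} (hbK : ∀ t x, ‖b t x‖ ≤ K) (hwK : ∀ t x, |w t x| ≤ K)
    {φ φ' : ℝ × Rn d → ℝ} {p : ℝ × Rn d} (h0 : |φ' p - φ p| ≤ ε)
    (h1 : ‖fderiv ℝ φ' p - fderiv ℝ φ p‖ ≤ ε) :
    |transportOp b w φ' p - transportOp b w φ p| ≤ (1 + 2 * K) * ε := by
  have hK : 0 ≤ K := (norm_nonneg _).trans (hbK 0 0)
  have e : transportOp b w φ' p - transportOp b w φ p
      = (fderiv ℝ φ' p - fderiv ℝ φ p) (1, b p.1.toNNReal p.2)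
        + w p.1.toNNReal p.2 * (φ' p - φ p) := by
    simp only [transportOp, sub_apply]
    ring
  have hε : 0 ≤ ε := (abs_nonneg _).trans h0
  have a1 : |(fderiv ℝ φ' p - fderiv ℝ φ p) (1, b p.1.toNNReal p.2)| ≤ ε * (1 + K) :=
    (ContinuousLinearMap.le_opNorm _ _).trans (mul_le_mul h1 (norm_one_prod_le hK (hbK _ _))
      (norm_nonneg _) hε)
  have a2 : |w p.1.toNNReal p.2 * (φ' p - φ p)| ≤ K * ε := by
    rw [abs_mul]
    exact mul_le_mul (hwK _ _) h0 (abs_nonneg _) hK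
  rw [e]
  refine (abs_add_le _ _).trans ?_
  linarith

lemma transportOp_eq_zero {S : Set (ℝ × Rn d)} (hS : IsCompact S) {φ : ℝ × Rn d → ℝ}
    (hφ : ∀ p ∉ S, φ p = 0) : ∀ p ∉ S, transportOp b w φ p = 0 := by
  intro p hp
  have h : φ =ᶠ[𝓝 p] fun _ => 0 := by
    filter_upwards [hS.isClosed.isOpen_compl.mem_nhds hp] with q hq using hφ q hq
  simp [transportOp, h.fderiv_eq, hφ p hp]

lemma exists_time_bound {S : Set (ℝ × Rn d)} (hS : IsCompact S) (T : ℝ) :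
    ∃ R > T, ∀ t x, (t, x) ∈ S → t ≤ R := by
  obtain ⟨R, hR⟩ := hS.isBounded.subset_closedBall 0
  refine ⟨max R (T + 1), (lt_add_one T).trans_le (le_max_right _ _), fun t x h => ?_⟩
  have h1 := hR h
  rw [mem_closedBall_zero_iff, norm_prod_le_iff] at h1
  exact (le_abs_self t).trans (h1.1.trans (le_max_left _ _))

lemma setIntegral_Ioi_eq {m : ℝ → ℝ} {R : ℝ} (hR : 0 ≤ R) (hm : ∀ t, R < t → m t = 0) :
    ∫ t in Ioi (0 : ℝ), m t = ∫ t in (0 : ℝ)..R, m t := by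
  rw [intervalIntegral.integral_of_le hR]
  refine (setIntegral_eq_of_subset_of_forall_sdiff_eq_zero measurableSet_Ioi
    Ioc_subset_Ioi_self fun t ht => hm t
    (not_le.mp fun h => ht.2 ⟨ht.1, h⟩))

lemma pairing_slice_eq_zero (μ : SignedMeasure (Rn d)) {S : Set (ℝ × Rn d)} {R : ℝ}
    (hR : ∀ t x, (t, x) ∈ S → t ≤ R) {g : ℝ × Rn d → ℝ} (hg : ∀ p ∉ S, g p = 0) {t : ℝ}
    (ht : R < t) : pairing μ (fun x => g (t, x)) = 0 := by
  have : (fun x => g (t, x)) = fun _ => 0 := by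
    funext x
    exact hg _ fun h => (hR t x h).not_gt ht
  rw [this, pairing_zero]

/-- The dual solutions used later are only `C¹`, since the coefficients are no better. The identity
is stable under `C¹` approximation with a common compact support: the error is `ε` times a constant
built from the mass on `[0,R]`, the coefficient bound and `ν₀`. -/
lemma IsWeakSolution.weak_eq_C1 (h : IsWeakSolution b w ν₀ ν)
    (hb : Continuous (Function.uncurry b)) (hw : Continuous (Function.uncurry w)) {K : ℝ}
    (hbK : ∀ t x, ‖b t x‖ ≤ K) (hwK : ∀ t x, |w t x| ≤ K)
    {φ : ℝ × Rn d → ℝ} (hφ : ContDiff ℝ 1 φ) (hc : HasCompactSupport φ) :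
    (∫ t in Ioi (0 : ℝ), pairing (ν t.toNNReal) (fun x => transportOp b w φ (t, x)))
      + pairing ν₀ (fun x => φ (0, x)) = 0 := by
  have hK : 0 ≤ K := (norm_nonneg _).trans (hbK 0 0)
  obtain ⟨S, hS, hφS, happ⟩ := exists_smooth_approx hφ hc
  obtain ⟨R, hR0, hR⟩ := exists_time_bound hS 0
  obtain ⟨M, hM0, hM⟩ := h.narrowlyContinuous.exists_bound R.toNNReal
  have hcont : ∀ {ψ : ℝ × Rn d → ℝ}, Continuous ψ → ∀ t, Continuous fun x => ψ (t, x) :=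
    fun hψ t => hψ.comp (Continuous.prodMk_right t)
  have hLc := continuous_transportOp hb hw hφ
  have hLs := hasCompactSupport_transportOp (b := b) (w := w) hc
  obtain ⟨C1, -, hC1⟩ := exists_bound_of_hasCompactSupport hLc hLs
  obtain ⟨C2, -, hC2⟩ := exists_bound_of_hasCompactSupport hφ.continuous hc
  have key : ∀ ε > 0, |(∫ t in Ioi (0 : ℝ),
      pairing (ν t.toNNReal) (fun x => transportOp b w φ (t, x))) + pairing ν₀ (fun x => φ (0, x))|
      ≤ (M * (1 + 2 * K) * R + massBound ν₀) * ε := by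
    intro ε hε
    obtain ⟨φ', hφ', hφ'S, h0, h1⟩ := happ ε hε
    have hφ'1 : ContDiff ℝ 1 φ' := hφ'.of_le (by exact_mod_cast le_top)
    have hc' : HasCompactSupport φ' := HasCompactSupport.intro hS fun p hp => hφ'S p hp
    have hw' := h.weak_eq_smooth hb hw hφ' hc'
    have hLc' := continuous_transportOp hb hw hφ'1
    have hLs' := hasCompactSupport_transportOp (b := b) (w := w) hc'
    obtain ⟨C1', -, hC1'⟩ := exists_bound_of_hasCompactSupport hLc' hLs'
    obtain ⟨C2', -, hC2'⟩ := exists_bound_of_hasCompactSupport hφ'.continuous hc'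
    have z : ∀ t, R < t → pairing (ν t.toNNReal) (fun x => transportOp b w φ (t, x)) = 0 :=
      fun t ht => pairing_slice_eq_zero _ hR (transportOp_eq_zero hS hφS) ht
    have z' : ∀ t, R < t → pairing (ν t.toNNReal) (fun x => transportOp b w φ' (t, x)) = 0 :=
      fun t ht => pairing_slice_eq_zero _ hR (transportOp_eq_zero hS hφ'S) ht
    have q1 : |(∫ t in (0 : ℝ)..R, pairing (ν t.toNNReal) (fun x => transportOp b w φ' (t, x)))
        - ∫ t in (0 : ℝ)..R, pairing (ν t.toNNReal) (fun x => transportOp b w φ (t, x))|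
        ≤ M * ((1 + 2 * K) * ε) * |R - 0| := by
      have i1 := (h.narrowlyContinuous.continuous_pairing hLc' hLs').intervalIntegrable
        (μ := volume) 0 R
      have i2 := (h.narrowlyContinuous.continuous_pairing hLc hLs).intervalIntegrable
        (μ := volume) 0 R
      rw [← intervalIntegral.integral_sub i1 i2]
      rw [← Real.norm_eq_abs]
      refine intervalIntegral.norm_integral_le_of_norm_le_const fun t ht => ?_
      rw [uIoc_of_le hR0.le] at ht
      rw [← pairing_sub _ (hcont hLc' t) (hcont hLc t) (fun x => hC1' _) (fun x => hC1 _)]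
      exact hM _ (Real.toNNReal_le_toNNReal ht.2) _ ((hcont hLc' t).sub (hcont hLc t)) _
        fun x => abs_transportOp_sub_le hbK hwK (h0 _) (h1 _)
    have q2 : |pairing ν₀ (fun x => φ' (0, x)) - pairing ν₀ (fun x => φ (0, x))|
        ≤ massBound ν₀ * ε := by
      rw [← pairing_sub _ (hcont hφ'.continuous 0) (hcont hφ.continuous 0) (fun x => hC2' _)
        (fun x => hC2 _)]
      exact abs_pairing_le _ fun x => h0 _
    rw [setIntegral_Ioi_eq hR0.le z'] at hw'
    rw [setIntegral_Ioi_eq hR0.le z]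
    rw [sub_zero, abs_of_pos hR0] at q1
    rw [abs_le] at q1 q2 ⊢
    constructor <;> nlinarith
  have hB : 0 ≤ M * (1 + 2 * K) * R + massBound ν₀ := by
    have := massBound_nonneg ν₀
    positivity
  by_contra hne
  have hpos := abs_pos.mpr hne
  -- With `B` the constant in `key` and `ε = |X| / (B + 1)`, the bound reads `|X| ≤ B |X| / (B +
  -- 1)`, impossible for `|X| > 0`.
  have h2 := key (_ / (M * (1 + 2 * K) * R + massBound ν₀ + 1)) (div_pos hpos (by positivity))
  rw [mul_div_assoc', le_div_iff₀ (by positivity)] at h2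
  nlinarith

/-- The zeroth-order term `w` is attributed entirely to `ψ`, so that `φ`, a cutoff or a function of
time, contributes only through its derivative. -/
lemma transportOp_mul {φ ψ : ℝ × Rn d → ℝ} (hφ : ContDiff ℝ 1 φ) (hψ : ContDiff ℝ 1 ψ)
    (p : ℝ × Rn d) :
    transportOp b w (fun q => φ q * ψ q) p
      = φ p * transportOp b w ψ p + ψ p * fderiv ℝ φ p (1, b p.1.toNNReal p.2) := by
  have h := ((hφ.differentiable one_ne_zero p).hasFDerivAt.mul
    (hψ.differentiable one_ne_zero p).hasFDerivAt).fderiv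
  unfold transportOp
  change fderiv ℝ (fun q => φ q * ψ q) p = _ at h
  rw [h]
  simp only [add_apply, smul_apply, smul_eq_mul]
  ring

lemma fderiv_time_mul {θ : ℝ → ℝ} (hθ : ContDiff ℝ 1 θ) (p v : ℝ × Rn d) :
    fderiv ℝ (fun q : ℝ × Rn d => θ q.1) p v = deriv θ p.1 * v.1 := by
  have h := ((hθ.differentiable one_ne_zero p.1).hasDerivAt.hasFDerivAt.comp p
    (hasFDerivAt_fst (𝕜 := ℝ) (E := ℝ) (F := Rn d) (p := p))).fderiv
  change fderiv ℝ (θ ∘ Prod.fst) p v = _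
  rw [h]
  simp [mul_comm]

/-- The weak formulation with a compactly supported `C¹` test function, integrated up to a fixed
time. -/
lemma IsWeakSolution.pairing_eq_add_integral (h : IsWeakSolution b w ν₀ ν)
    (hb : Continuous (Function.uncurry b)) (hw : Continuous (Function.uncurry w)) {K : ℝ}
    (hbK : ∀ t x, ‖b t x‖ ≤ K) (hwK : ∀ t x, |w t x| ≤ K)
    {φ : ℝ × Rn d → ℝ} (hφ : ContDiff ℝ 1 φ) (hc : HasCompactSupport φ) {t : ℝ} (ht : 0 ≤ t) :
    pairing (ν t.toNNReal) (fun x => φ (t, x)) = pairing ν₀ (fun x => φ (0, x))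
      + ∫ s in (0 : ℝ)..t, pairing (ν s.toNNReal) (fun x => transportOp b w φ (s, x)) := by
  -- `R` lies beyond `t` and beyond the support of `φ` in time; hence the integrals over `(0,∞)`
  -- stop at `R` and the time factors `θ` need not vanish there.
  obtain ⟨R, hRt, hR⟩ := exists_time_bound hc.isCompact t
  have hφS : ∀ p ∉ tsupport φ, φ p = 0 := fun p hp => image_eq_zero_of_notMem_tsupport hp
  have hLc := continuous_transportOp hb hw hφ
  have hLs := hasCompactSupport_transportOp (b := b) (w := w) hc
  obtain ⟨C1, -, hC1⟩ := exists_bound_of_hasCompactSupport hLc hLs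
  obtain ⟨C2, -, hC2⟩ := exists_bound_of_hasCompactSupport hφ.continuous hc
  refine eq_add_integral_of_weak (h.narrowlyContinuous.continuous_pairing hφ.continuous hc)
    (h.narrowlyContinuous.continuous_pairing hLc hLs) (ht.trans_lt hRt) (fun θ hθ => ?_) t
    ⟨ht, hRt.le⟩
  have hθφ : ContDiff ℝ 1 fun p : ℝ × Rn d => θ p.1 * φ p := (hθ.comp contDiff_fst).mul hφ
  have hcθ : HasCompactSupport fun p : ℝ × Rn d => θ p.1 * φ p := hc.mul_left
  have key := h.weak_eq_C1 hb hw hbK hwK hθφ hcθ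
  have e : ∀ s : ℝ, pairing (ν s.toNNReal)
      (fun x => transportOp b w (fun p : ℝ × Rn d => θ p.1 * φ p) (s, x))
      = deriv θ s * pairing (ν s.toNNReal) (fun x => φ (s, x))
        + θ s * pairing (ν s.toNNReal) (fun x => transportOp b w φ (s, x)) := by
    intro s
    rw [← pairing_const_mul, ← pairing_const_mul, ← pairing_add (A := |deriv θ s| * C2)
      (B := |θ s| * C1)]
    · congr 1
      funext x
      rw [transportOp_mul (φ := fun q : ℝ × Rn d => θ q.1) (hθ.comp contDiff_fst) hφ (s, x),
        fderiv_time_mul hθ]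
      ring
    · exact continuous_const.mul (hφ.continuous.comp (Continuous.prodMk_right s))
    · exact continuous_const.mul (hLc.comp (Continuous.prodMk_right s))
    · intro x
      rw [abs_mul]
      exact mul_le_mul_of_nonneg_left (hC2 _) (abs_nonneg _)
    · intro x
      rw [abs_mul]
      exact mul_le_mul_of_nonneg_left (hC1 _) (abs_nonneg _)
  simp only [e] at key
  rw [pairing_const_mul, setIntegral_Ioi_eq (ht.trans hRt.le) fun s hs => ?_] at key
  · exact key
  · rw [pairing_slice_eq_zero _ hR hφS hs,
      pairing_slice_eq_zero _ hR (transportOp_eq_zero hc.isCompact hφS) hs, mul_zero, mul_zero,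
      add_zero]

/-- Comparison of a weak solution at two times through an approximate dual solution. -/
lemma IsWeakSolution.abs_pairing_sub_le (h : IsWeakSolution b w ν₀ ν)
    (hb : Continuous (Function.uncurry b)) (hw : Continuous (Function.uncurry w)) {K : ℝ}
    (hbK : ∀ t x, ‖b t x‖ ≤ K) (hwK : ∀ t x, |w t x| ≤ K) {M t₁ t₂ : ℝ} (ht₁ : 0 ≤ t₁)
    (ht : t₁ ≤ t₂)
    (hM : ∀ t ≤ t₂.toNNReal, ∀ g : Rn d → ℝ, Continuous g → ∀ C : ℝ, (∀ x, |g x| ≤ C) →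
      |pairing (ν t) g| ≤ M * C)
    {ψ : ℝ × Rn d → ℝ} (hψ : ContDiff ℝ 1 ψ) {A ε : ℝ}
    (hA : ∀ s ∈ Icc t₁ t₂, ∀ x, |ψ (s, x)| ≤ A)
    (hε : ∀ s ∈ Icc t₁ t₂, ∀ x, |transportOp b w ψ (s, x)| ≤ ε) :
    |pairing (ν t₂.toNNReal) (fun x => ψ (t₂, x)) - pairing (ν t₁.toNNReal) (fun x => ψ (t₁, x))|
      ≤ M * ε * (t₂ - t₁) := by
  have hK : 0 ≤ K := (norm_nonneg _).trans (hbK 0 0)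
  have hA0 : 0 ≤ A := (abs_nonneg _).trans (hA t₁ ⟨le_rfl, ht⟩ 0)
  obtain ⟨κ, C, hC, κ1, κ2, κ3, κ4, κ5⟩ := exists_cutoff (E := ℝ × Rn d)
  have hlim : ∀ s ∈ Icc t₁ t₂, Tendsto
      (fun n => pairing (ν s.toNNReal) (fun x => κ n (s, x) * ψ (s, x))) atTop
      (𝓝 (pairing (ν s.toNNReal) (fun x => ψ (s, x)))) := by
    intro s hs
    refine tendsto_pairing _ (C := A) (fun n => ?_) (fun n x => ?_) fun x => ?_
    · exact ((κ1 n).continuous.mul hψ.continuous).comp (Continuous.prodMk_right s)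
    · rw [abs_mul]
      exact (mul_le_mul (κ3 n _) (hA s hs x) (abs_nonneg _) zero_le_one).trans (one_mul A).le
    · simpa using (κ5 (s, x)).mul_const (ψ (s, x))
  -- `κ n * ψ` is compactly supported, and its residual exceeds that of `ψ` by at most `A` times the
  -- derivative of the cutoff along `(1, b)`, which is of order `1/(n+1)`.
  have hbound : ∀ n : ℕ, |pairing (ν t₂.toNNReal) (fun x => κ n (t₂, x) * ψ (t₂, x))
      - pairing (ν t₁.toNNReal) (fun x => κ n (t₁, x) * ψ (t₁, x))|
      ≤ M * (ε + A * (C * (1 / ((n : ℝ) + 1)) * (1 + K))) * (t₂ - t₁) := by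
    intro n
    have hφ : ContDiff ℝ 1 fun p => κ n p * ψ p := (κ1 n).mul hψ
    have hc : HasCompactSupport fun p => κ n p * ψ p := (κ2 n).mul_right
    have hLc := continuous_transportOp hb hw hφ
    have hint := h.narrowlyContinuous.continuous_pairing hLc
      (hasCompactSupport_transportOp (b := b) (w := w) hc)
    rw [h.pairing_eq_add_integral hb hw hbK hwK hφ hc (ht₁.trans ht),
      h.pairing_eq_add_integral hb hw hbK hwK hφ hc ht₁, add_sub_add_left_eq_sub,
      intervalIntegral.integral_interval_sub_left (hint.intervalIntegrable _ _)
        (hint.intervalIntegrable _ _)]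
    have hle : ∀ s ∈ uIoc t₁ t₂, ‖pairing (ν s.toNNReal)
        (fun x => transportOp b w (fun p => κ n p * ψ p) (s, x))‖
        ≤ M * (ε + A * (C * (1 / ((n : ℝ) + 1)) * (1 + K))) := by
      intro s hs
      rw [uIoc_of_le ht] at hs
      have hs' : s ∈ Icc t₁ t₂ := ⟨hs.1.le, hs.2⟩
      refine hM _ (Real.toNNReal_le_toNNReal hs.2) _ (hLc.comp (Continuous.prodMk_right s)) _
        fun x => ?_
      rw [Function.comp_apply, transportOp_mul (κ1 n) hψ]
      refine (abs_add_le _ _).trans (add_le_add ?_ ?_)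
      · rw [abs_mul]
        exact (mul_le_mul (κ3 n _) (hε s hs' x) (abs_nonneg _) zero_le_one).trans (one_mul ε).le
      · rw [abs_mul]
        refine mul_le_mul (hA s hs' x) ?_ (abs_nonneg _) hA0
        exact (ContinuousLinearMap.le_opNorm _ _).trans (mul_le_mul (κ4 n _)
          (norm_one_prod_le hK (hbK _ _)) (norm_nonneg _) (by positivity))
    have := intervalIntegral.norm_integral_le_of_norm_le_const hle
    rwa [abs_of_nonneg (sub_nonneg.mpr ht)] at this
  refine le_of_tendsto_of_tendsto
    (((hlim t₂ ⟨ht, le_rfl⟩).sub (hlim t₁ ⟨le_rfl, ht⟩)).abs) ?_ (Eventually.of_forall hbound)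
  have h1 : Tendsto (fun n : ℕ => M * (ε + A * (C * (1 / ((n : ℝ) + 1)) * (1 + K))) * (t₂ - t₁))
      atTop (𝓝 (M * (ε + A * (C * 0 * (1 + K))) * (t₂ - t₁))) :=
    ((((tendsto_one_div_add_atTop_nhds_zero_nat.const_mul C).mul_const (1 + K)).const_mul
      A).const_add ε).const_mul M |>.mul_const (t₂ - t₁)
  simpa using h1

/-- A weak solution attains its initial value. -/
lemma IsWeakSolution.pairing_initial (h : IsWeakSolution b w ν₀ ν)
    (hb : Continuous (Function.uncurry b)) (hw : Continuous (Function.uncurry w)) {K : ℝ}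
    (hbK : ∀ t x, ‖b t x‖ ≤ K) (hwK : ∀ t x, |w t x| ≤ K) {f : Rn d → ℝ} (hf : ContDiff ℝ 1 f)
    {A : ℝ} (hA : ∀ x, |f x| ≤ A) : pairing (ν 0) f = pairing ν₀ f := by
  obtain ⟨κ, C, hC, κ1, κ2, κ3, κ4, κ5⟩ := exists_cutoff (E := ℝ × Rn d)
  have hlim : ∀ μ : SignedMeasure (Rn d), Tendsto
      (fun n => pairing μ (fun x => κ n (0, x) * f x)) atTop (𝓝 (pairing μ f)) := by
    intro μ
    refine tendsto_pairing _ (C := A) (fun n => ?_) (fun n x => ?_) fun x => ?_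
    · exact ((κ1 n).continuous.comp (Continuous.prodMk_right 0)).mul hf.continuous
    · rw [abs_mul]
      exact (mul_le_mul (κ3 n _) (hA x) (abs_nonneg _) zero_le_one).trans (one_mul A).le
    · simpa using (κ5 (0, x)).mul_const (f x)
  refine tendsto_nhds_unique ((hlim (ν 0)).congr fun n => ?_) (hlim ν₀)
  have := h.pairing_eq_add_integral hb hw hbK hwK
    (φ := fun p => κ n p * f p.2) ((κ1 n).mul (hf.comp contDiff_snd)) (κ2 n).mul_right le_rfl
  simpa using this

end WeakFormC1

/-! ### One backward Euler step of the dual equation -/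

section DualStep

variable {E : Type*} [NormedAddCommGroup E] [NormedSpace ℝ E]

/-- A `C¹` function that is bounded by `A` together with its derivative. -/
structure IsC1Bounded (A : ℝ) (f : E → ℝ) : Prop where
  contDiff : ContDiff ℝ 1 f
  abs_le : ∀ x, |f x| ≤ A
  fderiv_le : ∀ x, ‖fderiv ℝ f x‖ ≤ A

/-- One step of the explicit Euler scheme for the dual transport equation. -/
def dualStep (β : E → E) (v : E → ℝ) (r : ℝ) (f : E → ℝ) (x : E) : ℝ :=
  f (x + r • β x) * Real.exp (r * v x)

variable {β : E → E} {v f : E → ℝ}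

lemma contDiff_dualStep (hβ : ContDiff ℝ 1 β) (hv : ContDiff ℝ 1 v) (hf : ContDiff ℝ 1 f)
    (t₂ : ℝ) : ContDiff ℝ 1 fun p : ℝ × E => dualStep β v (t₂ - p.1) f p.2 := by
  unfold dualStep
  fun_prop

/-- One formula serves twice: the direction `(0,u)` gives the spatial derivative of a step, and
`(1,b)` gives the residual of the step as a test function in the transport equation. -/
lemma fderiv_dualStep (hβ : ContDiff ℝ 1 β) (hv : ContDiff ℝ 1 v) (hf : ContDiff ℝ 1 f)
    (t₂ s σ : ℝ) (x u : E) :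
    fderiv ℝ (fun p : ℝ × E => dualStep β v (t₂ - p.1) f p.2) (s, x) (σ, u)
      = Real.exp ((t₂ - s) * v x) *
        (fderiv ℝ f (x + (t₂ - s) • β x) (u + (t₂ - s) • fderiv ℝ β x u - σ • β x)
          + f (x + (t₂ - s) • β x) * ((t₂ - s) * fderiv ℝ v x u - σ * v x)) := by
  have hr : HasFDerivAt (fun p : ℝ × E => t₂ - p.1) (-ContinuousLinearMap.fst ℝ ℝ E) (s, x) :=
    hasFDerivAt_fst.const_sub t₂
  have hx : HasFDerivAt (fun p : ℝ × E => p.2) (ContinuousLinearMap.snd ℝ ℝ E) (s, x) :=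
    hasFDerivAt_snd
  have hβ' := (hβ.differentiable one_ne_zero x).hasFDerivAt.comp (s, x) hx
  have hv' := (hv.differentiable one_ne_zero x).hasFDerivAt.comp (s, x) hx
  have hy := hx.add (hr.smul hβ')
  have hf' := (hf.differentiable one_ne_zero (x + (t₂ - s) • β x)).hasFDerivAt.comp (s, x) hy
  have h := (hf'.mul (hr.mul hv').exp).fderiv
  change fderiv ℝ (fun p : ℝ × E => dualStep β v (t₂ - p.1) f p.2) (s, x) = _ at h
  rw [h]
  simp
  ring

/-- Bound for the derivative of a product of the kind occurring in `fderiv_dualStep`. -/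
lemma abs_exp_mul_le {A B K r a c q : ℝ} {y : E} {e : E} (hf : IsC1Bounded A f)
    (ha : |a| ≤ r * K) (he : ‖e‖ ≤ B) (hc : |c| ≤ q) :
    |Real.exp a * (fderiv ℝ f y e + f y * c)| ≤ Real.exp (r * K) * (A * B + A * q) := by
  have hA : 0 ≤ A := (abs_nonneg _).trans (hf.abs_le 0)
  rw [abs_mul, Real.abs_exp]
  refine mul_le_mul (Real.exp_le_exp.mpr ((le_abs_self a).trans ha)) ?_ (abs_nonneg _)
    (Real.exp_pos _).le
  refine (abs_add_le _ _).trans (add_le_add ?_ ?_)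
  · exact (ContinuousLinearMap.le_opNorm _ _).trans
      (mul_le_mul (hf.fderiv_le _) he (norm_nonneg _) hA)
  · rw [abs_mul]
    exact mul_le_mul (hf.abs_le _) hc (abs_nonneg _) hA

lemma abs_mul_le_of_le {r K a : ℝ} (hr : 0 ≤ r) (ha : |a| ≤ K) : |r * a| ≤ r * K := by
  rw [abs_mul, abs_of_nonneg hr]
  exact mul_le_mul_of_nonneg_left ha hr

/-- The exponential weight contributes `e^{Kr}`, while differentiating `x + r β(x)` and `r v(x)`
gives `1 + 2Kr ≤ e^{2Kr}`; hence the rate `3K`. A purely exponential factor, without a prefactor,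
keeps the bound under control when steps are composed. -/
lemma IsC1Bounded.dualStep {A K r : ℝ} (hf : IsC1Bounded A f) (hβ : ContDiff ℝ 1 β)
    (hv : ContDiff ℝ 1 v) (hvK : ∀ x, |v x| ≤ K) (hβ' : ∀ x, ‖fderiv ℝ β x‖ ≤ K)
    (hv' : ∀ x, ‖fderiv ℝ v x‖ ≤ K) (hr : 0 ≤ r) :
    IsC1Bounded (A * Real.exp (3 * K * r)) (dualStep β v r f) := by
  have hA : 0 ≤ A := (abs_nonneg _).trans (hf.abs_le 0)
  have hK : 0 ≤ K := (abs_nonneg _).trans (hvK 0)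
  have hψ := contDiff_dualStep hβ hv hf.contDiff r
  have hin : ContDiff ℝ 1 fun x : E => ((0 : ℝ), x) := contDiff_const.prodMk contDiff_id
  have heq : TransportMeasures.dualStep β v r f
      = (fun p : ℝ × E => TransportMeasures.dualStep β v (r - p.1) f p.2)
        ∘ fun x : E => ((0 : ℝ), x) := by
    funext x
    simp
  refine ⟨?_, fun x => ?_, fun x => ?_⟩
  · rw [heq]
    exact hψ.comp hin
  · unfold TransportMeasures.dualStep
    rw [abs_mul, Real.abs_exp]
    refine mul_le_mul (hf.abs_le _) (Real.exp_le_exp.mpr ?_) (Real.exp_pos _).le hA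
    have h1 := (le_abs_self _).trans (abs_mul_le_of_le hr (hvK x))
    nlinarith
  · refine ContinuousLinearMap.opNorm_le_bound _ (by positivity) fun u => ?_
    have h1 : fderiv ℝ (TransportMeasures.dualStep β v r f) x u
        = fderiv ℝ (fun p : ℝ × E => TransportMeasures.dualStep β v (r - p.1) f p.2)
          (0, x) (0, u) := by
      have h2 := ((hψ.differentiable one_ne_zero (0, x)).hasFDerivAt.comp x
        (hasFDerivAt_prodMk_right (0 : ℝ) x)).fderiv
      rw [← heq] at h2
      rw [h2]
      rfl
    rw [h1, fderiv_dualStep hβ hv hf.contDiff]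
    simp only [sub_zero, zero_smul, zero_mul]
    have hb1 : ‖u + r • fderiv ℝ β x u‖ ≤ (1 + r * K) * ‖u‖ := by
      refine (norm_add_le _ _).trans ?_
      rw [norm_smul, Real.norm_of_nonneg hr]
      have := (ContinuousLinearMap.le_opNorm (fderiv ℝ β x) u).trans
        (mul_le_mul_of_nonneg_right (hβ' x) (norm_nonneg u))
      nlinarith [mul_le_mul_of_nonneg_left this hr]
    have hb2 : |r * fderiv ℝ v x u| ≤ r * (K * ‖u‖) :=
      abs_mul_le_of_le hr ((ContinuousLinearMap.le_opNorm (fderiv ℝ v x) u).trans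
        (mul_le_mul_of_nonneg_right (hv' x) (norm_nonneg u)))
    refine (abs_exp_mul_le hf (abs_mul_le_of_le hr (hvK x)) hb1 hb2).trans ?_
    have h3 : 1 + 2 * (r * K) ≤ Real.exp (2 * (r * K)) := by
      rw [add_comm]
      exact Real.add_one_le_exp _
    have h4 : Real.exp (3 * K * r) = Real.exp (r * K) * Real.exp (2 * (r * K)) := by
      rw [← Real.exp_add]
      congr 1
      ring
    rw [h4]
    calc Real.exp (r * K) * (A * ((1 + r * K) * ‖u‖) + A * (r * (K * ‖u‖)))
        = A * (Real.exp (r * K) * (1 + 2 * (r * K))) * ‖u‖ := by ring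
      _ ≤ A * (Real.exp (r * K) * Real.exp (2 * (r * K))) * ‖u‖ := by gcongr

end DualStep

/-! ### Representation of weak solutions by the Euler scheme -/

section EulerScheme

variable {d : ℕ}

/-- Coefficients that are continuous in time, uniformly in space, and bounded by `K` together with
their spatial derivatives. -/
structure RegularCoeff (b : ℝ≥0 → Rn d → Rn d) (w : ℝ≥0 → Rn d → ℝ) (K : ℝ) : Prop where
  continuous_b : Continuous (Function.uncurry b)
  continuous_w : Continuous (Function.uncurry w)
  contDiff_b : ∀ t, ContDiff ℝ 1 (b t)
  contDiff_w : ∀ t, ContDiff ℝ 1 (w t)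
  norm_b_le : ∀ t x, ‖b t x‖ ≤ K
  abs_w_le : ∀ t x, |w t x| ≤ K
  fderiv_b_le : ∀ t x, ‖fderiv ℝ (b t) x‖ ≤ K
  fderiv_w_le : ∀ t x, ‖fderiv ℝ (w t) x‖ ≤ K
  modulus : ∀ T : ℝ≥0, ∀ δ > 0, ∃ η > 0, ∀ s ≤ T, ∀ t ≤ T, dist s t ≤ η → ∀ x,
    ‖b s x - b t x‖ ≤ δ ∧ |w s x - w t x| ≤ δ

/-- The explicit Euler scheme for `x' = b(t, x)`, `z' = w(t, x)`, started at `(x, 0)`. -/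
def eulerState (b : ℝ≥0 → Rn d → Rn d) (w : ℝ≥0 → Rn d → ℝ) (τ : ℝ≥0) : ℕ → Rn d → Rn d × ℝ
  | 0, x => (x, 0)
  | k + 1, x => eulerState b w τ k x
      + (τ : ℝ) • (b (k * τ) (eulerState b w τ k x).1, w (k * τ) (eulerState b w τ k x).1)

variable {b : ℝ≥0 → Rn d → Rn d} {w : ℝ≥0 → Rn d → ℝ} {K : ℝ} {ν₀ : SignedMeasure (Rn d)}
  {ν : ℝ≥0 → SignedMeasure (Rn d)}

lemma RegularCoeff.nonneg (hc : RegularCoeff b w K) : 0 ≤ K :=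
  (norm_nonneg _).trans (hc.norm_b_le 0 0)

lemma RegularCoeff.continuous_eulerState (hc : RegularCoeff b w K) (τ : ℝ≥0) (k : ℕ) :
    Continuous (eulerState b w τ k) := by
  induction k with
  | zero => exact continuous_id.prodMk continuous_const
  | succ k ih =>
    have hb := (hc.contDiff_b (k * τ)).continuous.comp (continuous_fst.comp ih)
    have hw := (hc.contDiff_w (k * τ)).continuous.comp (continuous_fst.comp ih)
    exact ih.add ((hb.prodMk hw).const_smul (τ : ℝ))

lemma RegularCoeff.abs_eulerState_snd_le (hc : RegularCoeff b w K) (τ : ℝ≥0) (k : ℕ) (x : Rn d) :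
    |(eulerState b w τ k x).2| ≤ K * (k * τ) := by
  induction k with
  | zero => simp [eulerState]
  | succ k ih =>
    simp only [eulerState, Prod.snd_add, Prod.smul_snd, smul_eq_mul]
    refine (abs_add_le _ _).trans
      ((add_le_add ih (abs_mul_le_of_le τ.coe_nonneg (hc.abs_w_le _ _))).trans (le_of_eq ?_))
    push_cast
    ring

/-- The weight `f(x_k) e^{z_k}` along the Euler scheme. -/
def eulerObs (b : ℝ≥0 → Rn d → Rn d) (w : ℝ≥0 → Rn d → ℝ) (τ : ℝ≥0) (k : ℕ) (f : Rn d → ℝ)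
    (x : Rn d) : ℝ :=
  f (eulerState b w τ k x).1 * Real.exp (eulerState b w τ k x).2

/-- Duality between the forward scheme and backward transport: the last forward step acts first on
the observable. -/
lemma eulerObs_succ (τ : ℝ≥0) (k : ℕ) (f : Rn d → ℝ) :
    eulerObs b w τ (k + 1) f
      = eulerObs b w τ k (dualStep (b (k * τ)) (w (k * τ)) τ f) := by
  funext x
  simp only [eulerObs, eulerState, dualStep, Prod.fst_add, Prod.snd_add, Prod.smul_fst,
    Prod.smul_snd, Real.exp_add, smul_eq_mul]
  ring

lemma RegularCoeff.continuous_eulerObs (hc : RegularCoeff b w K) (τ : ℝ≥0) (k : ℕ)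
    {f : Rn d → ℝ} (hf : Continuous f) : Continuous (eulerObs b w τ k f) :=
  (hf.comp (continuous_fst.comp (hc.continuous_eulerState τ k))).mul
    (Real.continuous_exp.comp (continuous_snd.comp (hc.continuous_eulerState τ k)))

lemma IsC1Bounded.nonneg {A : ℝ} {f : Rn d → ℝ} (hf : IsC1Bounded A f) : 0 ≤ A :=
  (abs_nonneg _).trans (hf.abs_le 0)

lemma RegularCoeff.abs_eulerObs_le (hc : RegularCoeff b w K) (τ : ℝ≥0) (k : ℕ)
    {f : Rn d → ℝ} {A : ℝ} (hA : ∀ x, |f x| ≤ A) (x : Rn d) :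
    |eulerObs b w τ k f x| ≤ A * Real.exp (K * (k * τ)) := by
  unfold eulerObs
  rw [abs_mul, Real.abs_exp]
  exact mul_le_mul (hA _) (Real.exp_le_exp.mpr ((le_abs_self _).trans
    (hc.abs_eulerState_snd_le τ k x))) (Real.exp_pos _).le ((abs_nonneg _).trans (hA 0))

/-- The test function `ψ(s,x)` carries `f` back from `t + τ` to `s` with coefficients frozen at `t`;
it is `f` at `s = t + τ` and the Euler step at `s = t`. Its residual comes from the time oscillation
`δ` of the coefficients and from the variation, at most `τ K²`, of the frozen coefficients along `r
b(s,x)`. -/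
lemma IsWeakSolution.abs_pairing_dualStep_le (h : IsWeakSolution b w ν₀ ν)
    (hc : RegularCoeff b w K) {M : ℝ} {t τ : ℝ≥0}
    (hM : ∀ s ≤ t + τ, ∀ g : Rn d → ℝ, Continuous g → ∀ C : ℝ, (∀ x, |g x| ≤ C) →
      |pairing (ν s) g| ≤ M * C) {δ : ℝ}
    (hδ : ∀ s, t ≤ s → s ≤ t + τ → ∀ x, ‖b s x - b t x‖ ≤ δ ∧ |w s x - w t x| ≤ δ)
    {f : Rn d → ℝ} {A : ℝ} (hf : IsC1Bounded A f) :
    |pairing (ν (t + τ)) f - pairing (ν t) (dualStep (b t) (w t) τ f)|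
      ≤ M * (Real.exp (τ * K) * (2 * A * (δ + τ * K ^ 2))) * τ := by
  have hK := hc.nonneg
  have hA := hf.nonneg
  have key := h.abs_pairing_sub_le hc.continuous_b hc.continuous_w hc.norm_b_le hc.abs_w_le
    (t₁ := t) (t₂ := ((t + τ : ℝ≥0) : ℝ)) (M := M) t.coe_nonneg
    (by push_cast; linarith [τ.coe_nonneg])
    (by rwa [Real.toNNReal_coe])
    (contDiff_dualStep (hc.contDiff_b t) (hc.contDiff_w t) hf.contDiff ((t + τ : ℝ≥0) : ℝ))
    (A := A * Real.exp (τ * K)) (ε := Real.exp (τ * K) * (2 * A * (δ + τ * K ^ 2)))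
    (fun s hs x => ?_) (fun s hs x => ?_)
  · rw [Real.toNNReal_coe, Real.toNNReal_coe] at key
    simp only [sub_self, NNReal.coe_add, add_sub_cancel_left] at key
    simp only [dualStep, zero_smul, add_zero, zero_mul, Real.exp_zero, mul_one] at key
    exact key
  · have hr : 0 ≤ ((t + τ : ℝ≥0) : ℝ) - s := sub_nonneg.mpr hs.2
    have hr' : ((t + τ : ℝ≥0) : ℝ) - s ≤ τ := by
      have := hs.1
      push_cast
      linarith
    unfold dualStep
    rw [abs_mul, Real.abs_exp]
    refine mul_le_mul (hf.abs_le _) (Real.exp_le_exp.mpr ((le_abs_self _).trans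
      ((abs_mul_le_of_le hr (hc.abs_w_le t x)).trans ?_))) (Real.exp_pos _).le hA
    exact mul_le_mul_of_nonneg_right hr' hK
  · have hr : 0 ≤ ((t + τ : ℝ≥0) : ℝ) - s := sub_nonneg.mpr hs.2
    have hr' : ((t + τ : ℝ≥0) : ℝ) - s ≤ τ := by
      have := hs.1
      push_cast
      linarith
    have hts : t ≤ s.toNNReal := NNReal.le_toNNReal_of_coe_le hs.1
    have hst : s.toNNReal ≤ t + τ := Real.toNNReal_le_iff_le_coe.mpr hs.2
    obtain ⟨hδb, hδw⟩ := hδ _ hts hst x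
    set r := ((t + τ : ℝ≥0) : ℝ) - s with hrdef
    -- The leading terms cancel: `b(s)` against the frozen `b(t)`, and `w(s)` against the frozen
    -- `w(t)`.
    have e : transportOp b w
        (fun p => dualStep (b t) (w t) (((t + τ : ℝ≥0) : ℝ) - p.1) f p.2) (s, x)
        = Real.exp (r * w t x) * (fderiv ℝ f (x + r • b t x)
            (b s.toNNReal x - b t x + r • fderiv ℝ (b t) x (b s.toNNReal x))
          + f (x + r • b t x) * (w s.toNNReal x - w t x
            + r * fderiv ℝ (w t) x (b s.toNNReal x))) := by
      unfold transportOp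
      rw [fderiv_dualStep (hc.contDiff_b t) (hc.contDiff_w t) hf.contDiff, ← hrdef]
      simp only [dualStep, ← hrdef]
      rw [one_smul, add_sub_right_comm]
      ring
    have hD1 : ‖fderiv ℝ (b t) x (b s.toNNReal x)‖ ≤ K * K :=
      (ContinuousLinearMap.le_opNorm _ _).trans (mul_le_mul (hc.fderiv_b_le _ _)
        (hc.norm_b_le _ _) (norm_nonneg _) hK)
    have hD2 : |fderiv ℝ (w t) x (b s.toNNReal x)| ≤ K * K :=
      (ContinuousLinearMap.le_opNorm _ _).trans (mul_le_mul (hc.fderiv_w_le _ _)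
        (hc.norm_b_le _ _) (norm_nonneg _) hK)
    have hKK : r * (K * K) ≤ τ * (K * K) := mul_le_mul_of_nonneg_right hr' (by positivity)
    rw [e]
    refine (abs_exp_mul_le hf (r := τ) (K := K) (B := δ + τ * K ^ 2) (q := δ + τ * K ^ 2)
      ((abs_mul_le_of_le hr (hc.abs_w_le t x)).trans (mul_le_mul_of_nonneg_right hr' hK))
      ?_ ?_).trans (le_of_eq ?_)
    · refine (norm_add_le _ _).trans (add_le_add hδb ?_)
      rw [norm_smul, Real.norm_of_nonneg hr]
      have := mul_le_mul_of_nonneg_left hD1 hr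
      nlinarith
    · refine (abs_add_le _ _).trans (add_le_add hδw ?_)
      have := abs_mul_le_of_le hr hD2
      nlinarith
    · ring

/-- Consistency plus stability: the `k` one-step errors add up, and the `C¹` bound of the observable
grows by `e^{3Kτ}` per step. The induction runs over all `f`, since each step replaces `f` by its
backward transport. -/
lemma IsWeakSolution.abs_pairing_eulerObs_le (h : IsWeakSolution b w ν₀ ν)
    (hc : RegularCoeff b w K) {M : ℝ} {T τ : ℝ≥0} (hM0 : 0 ≤ M)
    (hM : ∀ s ≤ T, ∀ g : Rn d → ℝ, Continuous g → ∀ C : ℝ, (∀ x, |g x| ≤ C) →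
      |pairing (ν s) g| ≤ M * C) {δ : ℝ} (hδ0 : 0 ≤ δ)
    (hδ : ∀ s ≤ T, ∀ t ≤ T, dist s t ≤ τ → ∀ x, ‖b s x - b t x‖ ≤ δ ∧ |w s x - w t x| ≤ δ)
    (k : ℕ) (hk : k * τ ≤ T) {f : Rn d → ℝ} {A : ℝ} (hf : IsC1Bounded A f) :
    |pairing (ν (k * τ)) f - pairing ν₀ (eulerObs b w τ k f)|
      ≤ k * (M * (Real.exp (τ * K) * (2 * (δ + τ * K ^ 2))) * τ) * A
        * Real.exp (3 * K * (k * τ)) := by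
  have hK := hc.nonneg
  induction k generalizing f A with
  | zero =>
    have : eulerObs b w τ 0 f = f := by
      funext x
      simp [eulerObs, eulerState]
    rw [this]
    simp [h.pairing_initial hc.continuous_b hc.continuous_w hc.norm_b_le hc.abs_w_le hf.contDiff
      hf.abs_le]
  | succ k ih =>
    have hA := hf.nonneg
    have hsucc : ((k + 1 : ℕ) : ℝ≥0) * τ = k * τ + τ := by
      push_cast
      ring
    rw [hsucc] at hk ⊢
    have hkT : k * τ ≤ T := le_self_add.trans hk
    have h1 := h.abs_pairing_dualStep_le hc (t := k * τ) (τ := τ) (M := M) (δ := δ)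
      (fun s hs => hM s (hs.trans hk)) (fun s hs hs' x => hδ s (hs'.trans hk) _ hkT (by
        rw [NNReal.dist_eq, abs_of_nonneg (sub_nonneg.mpr (NNReal.coe_le_coe.mpr hs))]
        have := NNReal.coe_le_coe.mpr hs'
        push_cast at this ⊢
        linarith) x) hf
    have hfs := hf.dualStep (hc.contDiff_b (k * τ)) (hc.contDiff_w (k * τ))
      (hc.abs_w_le (k * τ)) (hc.fderiv_b_le (k * τ)) (hc.fderiv_w_le (k * τ)) τ.coe_nonneg
    have h2 := ih hkT hfs
    rw [eulerObs_succ]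
    set c := M * (Real.exp (τ * K) * (2 * (δ + τ * K ^ 2))) * τ with hcdef
    have hc0 : 0 ≤ c := by positivity
    have e1 : M * (Real.exp (τ * K) * (2 * A * (δ + τ * K ^ 2))) * τ = c * A := by
      rw [hcdef]
      ring
    have e2 : (k : ℝ) * c * (A * Real.exp (3 * K * ((τ : ℝ≥0) : ℝ)))
        * Real.exp (3 * K * (k * τ)) = k * c * A * Real.exp (3 * K * ((k + 1 : ℕ) * τ)) := by
      rw [mul_assoc, mul_assoc A, ← Real.exp_add]
      push_cast
      ring_nf
    have e3 : c * A ≤ c * A * Real.exp (3 * K * ((k + 1 : ℕ) * τ)) :=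
      le_mul_of_one_le_right (by positivity) (Real.one_le_exp (by positivity))
    rw [e1] at h1
    change |_ - _| ≤ (k : ℝ) * c * (A * Real.exp (3 * K * ((τ : ℝ≥0) : ℝ)))
        * Real.exp (3 * K * (k * τ)) at h2
    rw [e2] at h2
    refine (abs_sub_le _ _ _).trans ((add_le_add (h1.trans e3) h2).trans (le_of_eq ?_))
    push_cast
    ring

/-- The dual Euler scheme represents the weak solution. -/
lemma IsWeakSolution.tendsto_eulerObs (h : IsWeakSolution b w ν₀ ν) (hc : RegularCoeff b w K)
    (T : ℝ≥0) {f : Rn d → ℝ} {A : ℝ} (hf : IsC1Bounded A f) :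
    Tendsto (fun n : ℕ => pairing ν₀ (eulerObs b w (T / (n + 1 : ℕ)) (n + 1) f)) atTop
      (𝓝 (pairing (ν T) f)) := by
  have hK := hc.nonneg
  have hA := hf.nonneg
  obtain ⟨M, hM0, hM⟩ := h.narrowlyContinuous.exists_bound T
  -- The rate `4K` is `3K` from stability plus `K` from `e^{τK}` with `τ ≤ T`. Once `τ K² ≤ δ`, the
  -- total error is at most `2 Q δ`, which the choice of `δ` makes smaller than `ε`.
  set Q : ℝ := 2 * T * M * A * Real.exp (4 * K * T) with hQ
  have hQ0 : 0 ≤ Q := by positivity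
  rw [Metric.tendsto_atTop]
  intro ε hε
  set δ : ℝ := ε / (2 * Q + 1) with hδ
  have hδ0 : 0 < δ := by positivity
  obtain ⟨η, hη, hmod⟩ := hc.modulus T δ hδ0
  have hlim : Tendsto (fun n : ℕ => (T : ℝ) / ((n + 1 : ℕ) : ℝ)) atTop (𝓝 0) :=
    (tendsto_const_div_atTop_nhds_zero_nat (T : ℝ)).comp (tendsto_add_atTop_nat 1)
  have hlim2 : Tendsto (fun n : ℕ => (T : ℝ) / ((n + 1 : ℕ) : ℝ) * K ^ 2) atTop (𝓝 0) := by
    simpa using hlim.mul_const (K ^ 2)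
  obtain ⟨N, hN⟩ := eventually_atTop.mp
    ((hlim.eventually (ge_mem_nhds hη)).and (hlim2.eventually (ge_mem_nhds hδ0)))
  refine ⟨N, fun n hn => ?_⟩
  obtain ⟨h1, h2⟩ := hN n hn
  set τ : ℝ≥0 := T / (n + 1 : ℕ) with hτ
  have hτ' : (τ : ℝ) = (T : ℝ) / ((n + 1 : ℕ) : ℝ) := by
    rw [hτ]
    push_cast
    rfl
  rw [← hτ'] at h1 h2
  have hnτ : ((n + 1 : ℕ) : ℝ≥0) * τ = T := by
    rw [hτ]
    field_simp
  have hnτ' : ((n + 1 : ℕ) : ℝ) * (τ : ℝ) = T := by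
    rw [← hnτ]
    push_cast
    rfl
  have hτT : (τ : ℝ) ≤ T := by
    rw [hτ']
    exact div_le_self T.2 (by push_cast; linarith [(Nat.cast_nonneg n : (0 : ℝ) ≤ n)])
  have key := h.abs_pairing_eulerObs_le hc hM0 hM hδ0.le
    (fun s hs t ht hst => hmod s hs t ht (hst.trans h1)) (n + 1) hnτ.le hf
  rw [hnτ] at key
  rw [dist_comm, Real.dist_eq]
  refine key.trans_lt ?_
  calc ((n + 1 : ℕ) : ℝ) * (M * (Real.exp (τ * K) * (2 * (δ + τ * K ^ 2))) * τ) * A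
        * Real.exp (3 * K * ((n + 1 : ℕ) * τ))
      = (((n + 1 : ℕ) : ℝ) * τ) * M * A * 2 * (δ + τ * K ^ 2) * (Real.exp (τ * K)
        * Real.exp (3 * K * (((n + 1 : ℕ) : ℝ) * τ))) := by ring
    _ ≤ T * M * A * 2 * (δ + δ) * Real.exp (4 * K * T) := by
        rw [hnτ', ← Real.exp_add]
        gcongr
        nlinarith
    _ = 2 * Q * δ := by
        rw [hQ]
        ring
    _ < (2 * Q + 1) * δ := by nlinarith
    _ = ε := by
        rw [hδ]
        field_simp

/-- Local Lipschitz continuity in time of a weak solution. -/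
lemma IsWeakSolution.exists_lipschitz (h : IsWeakSolution b w ν₀ ν) (hc : RegularCoeff b w K)
    (T : ℝ≥0) : ∃ C : ℝ, 0 ≤ C ∧ ∀ s t : ℝ≥0, s ≤ t → t ≤ T → ∀ f : Rn d → ℝ, ∀ A : ℝ,
      IsC1Bounded A f → |pairing (ν t) f - pairing (ν s) f| ≤ C * A * (t - s) := by
  have hK := hc.nonneg
  obtain ⟨M, hM0, hM⟩ := h.narrowlyContinuous.exists_bound T
  refine ⟨M * (2 * K), by positivity, fun s t hst htT f A hf => ?_⟩
  have hA := hf.nonneg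
  -- A test function constant in time has residual `b · ∇f + w f`, at most `2 K A`.
  have hψ : ContDiff ℝ 1 fun p : ℝ × Rn d => f p.2 := hf.contDiff.comp contDiff_snd
  have key := h.abs_pairing_sub_le hc.continuous_b hc.continuous_w hc.norm_b_le hc.abs_w_le
    (t₁ := s) (t₂ := t) (M := M) s.2 (NNReal.coe_le_coe.mpr hst)
    (by rw [Real.toNNReal_coe]; exact fun u hu => hM u (hu.trans htT)) hψ (A := A)
    (ε := 2 * K * A) (fun _ _ x => hf.abs_le x) (fun u _ x => ?_)
  · simp only [Real.toNNReal_coe] at key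
    refine key.trans (le_of_eq ?_)
    ring
  · have hd := ((hf.contDiff.differentiable one_ne_zero x).hasFDerivAt.comp (u, x)
      (hasFDerivAt_snd (𝕜 := ℝ) (E := ℝ) (F := Rn d) (p := (u, x)))).fderiv
    change fderiv ℝ (fun p : ℝ × Rn d => f p.2) (u, x) = _ at hd
    unfold transportOp
    rw [hd]
    have h1 : |fderiv ℝ f x (b u.toNNReal x)| ≤ A * K :=
      (ContinuousLinearMap.le_opNorm _ _).trans (mul_le_mul (hf.fderiv_le x) (hc.norm_b_le _ _)
        (norm_nonneg _) hA)
    have h2 : |w u.toNNReal x * f x| ≤ K * A := by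
      rw [abs_mul]
      exact mul_le_mul (hc.abs_w_le _ _) (hf.abs_le x) (abs_nonneg _) hK
    refine (abs_add_le _ _).trans ((add_le_add h1 h2).trans (le_of_eq ?_))
    ring

end EulerScheme

/-! ### A second-difference criterion for `C¹` -/

section SecondDifferences

lemma exists_uniform_limit_of_geometric {X : Type*} [NormedAddCommGroup X] [CompleteSpace X]
    {Q : ℕ → ℝ → X} {u : Set ℝ} {B q : ℝ} (hq : q < 1)
    (h : ∀ n, ∀ x ∈ u, ‖Q n x - Q (n + 1) x‖ ≤ B * q ^ n) (hq0 : 0 ≤ q) :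
    ∃ D : ℝ → X, TendstoUniformlyOn Q D atTop u := by
  have hlim : ∀ x ∈ u, ∃ y, Tendsto (fun n => Q n x) atTop (𝓝 y) := fun x hx =>
    cauchySeq_tendsto_of_complete (cauchySeq_of_le_geometric q B hq fun n => by
      rw [dist_eq_norm]
      exact h n x hx)
  choose! D hD using hlim
  refine ⟨D, ?_⟩
  rw [Metric.tendstoUniformlyOn_iff]
  intro ε hε
  have h0 : Tendsto (fun n : ℕ => B * q ^ n / (1 - q)) atTop (𝓝 0) := by
    simpa using ((tendsto_pow_atTop_nhds_zero_of_lt_one hq0 hq).const_mul B).div_const (1 - q)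
  filter_upwards [h0.eventually (gt_mem_nhds hε)] with n hn x hx
  rw [dist_comm]
  refine (dist_le_of_le_geometric_of_tendsto q B hq (fun n => ?_) (hD x hx) n).trans_lt hn
  rw [dist_eq_norm]
  exact h n x hx

variable {X : Type*} [NormedAddCommGroup X] [NormedSpace ℝ X] [CompleteSpace X]

/-- A continuous function on the line whose second differences of step `k` are of size `k ^ (1+α)`
near a point is continuously differentiable near that point. -/
lemma contDiffOn_of_second_difference_local {G : ℝ → X} (hG : Continuous G) {h₀ r C α : ℝ}
    (hr : 0 < r) (hα : 0 < α)
    (h2 : ∀ x k, x - k ∈ Icc (h₀ - 2 * r) (h₀ + 2 * r) → x + k ∈ Icc (h₀ - 2 * r) (h₀ + 2 * r) →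
      0 ≤ k → ‖G (x + k) + G (x - k) - (2 : ℝ) • G x‖ ≤ C * k ^ (1 + α)) :
    ContDiffOn ℝ 1 G (Ioo (h₀ - r) (h₀ + r)) := by
  set u := Ioo (h₀ - r) (h₀ + r) with hu
  set δ : ℕ → ℝ := fun n => r * (1 / 2) ^ n with hδ
  have hδ0 : ∀ n, 0 < δ n := fun n => by positivity
  have hδr : ∀ n, δ n ≤ r := fun n =>
    mul_le_of_le_one_right hr.le (pow_le_one₀ (by norm_num) (by norm_num))
  have hδs : ∀ n, δ n = 2 * δ (n + 1) := fun n => by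
    simp only [hδ, pow_succ]
    ring
  have hδlim : Tendsto δ atTop (𝓝[≠] 0) := by
    refine tendsto_nhdsWithin_iff.mpr ⟨?_, Eventually.of_forall fun n => (hδ0 n).ne'⟩
    have h := (tendsto_pow_atTop_nhds_zero_of_lt_one (r := (1 / 2 : ℝ)) (by norm_num)
      (by norm_num)).const_mul r
    rwa [mul_zero] at h
  set Q : ℕ → ℝ → X := fun n x => (δ n)⁻¹ • (G (x + δ n) - G x) with hQ
  -- The means `A n` of `G` over `[x, x + δ n]` converge to `G` and have the difference quotients `Q
  -- n` as derivatives. Uniform convergence of `Q n` therefore makes `G` differentiable, with the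
  -- limit as derivative.
  set I : ℝ → X := fun x => ∫ t in (0 : ℝ)..x, G t with hI
  have hId : ∀ x, HasDerivAt I (G x) x := fun x => (hG.integral_hasStrictDerivAt 0 x).hasDerivAt
  set A : ℕ → ℝ → X := fun n x => (δ n)⁻¹ • (I (x + δ n) - I x) with hA
  have hAd : ∀ n x, HasDerivAt (A n) (Q n x) x := fun n x =>
    (((hId (x + δ n)).comp_add_const x (δ n)).sub (hId x)).const_smul _
  have hAlim : ∀ x, Tendsto (fun n => A n x) atTop (𝓝 (G x)) := fun x =>
    (hId x).tendsto_slope_zero.comp hδlim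
  have hQc : ∀ n, Continuous (Q n) := fun n => by fun_prop
  have hstep : ∀ n, ∀ x ∈ u, ‖Q n x - Q (n + 1) x‖
      ≤ (C / 2 * (r / 2) ^ α) * ((1 / 2 : ℝ) ^ α) ^ n := by
    intro n x hx
    set k := δ (n + 1) with hk
    have hk0 : 0 < k := hδ0 _
    have hkr : 2 * k ≤ r := (hδs n) ▸ hδr n
    have h3 := h2 (x + k) k ⟨by linarith [hx.1], by linarith [hx.2]⟩
      ⟨by linarith [hx.1], by linarith [hx.2]⟩ hk0.le
    -- Halving the step changes the quotient by a second difference centred at `x + k`, divided by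
    -- `2k`. This is of order `k^α`, hence geometrically small along the dyadic steps.
    have e : Q n x - Q (n + 1) x
        = (2 * k)⁻¹ • (G (x + k + k) + G (x + k - k) - (2 : ℝ) • G (x + k)) := by
      simp only [hQ]
      rw [hδs n, ← hk, add_sub_cancel_right, add_assoc, ← two_mul]
      have : k⁻¹ = (2 * k)⁻¹ * 2 := by
        field_simp
      rw [this, mul_smul, ← smul_sub]
      congr 1
      module
    rw [e, norm_smul, Real.norm_of_nonneg (by positivity)]
    refine (mul_le_mul_of_nonneg_left h3 (by positivity)).trans (le_of_eq ?_)
    have hkα : k ^ α = (r / 2) ^ α * ((1 / 2 : ℝ) ^ α) ^ n := by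
      rw [← Real.rpow_natCast, ← Real.rpow_mul (by norm_num), mul_comm α,
        Real.rpow_mul (by norm_num), Real.rpow_natCast,
        ← Real.mul_rpow (by positivity) (by positivity)]
      congr 1
      simp only [hk, hδ, pow_succ]
      ring
    rw [Real.rpow_add hk0, Real.rpow_one, mul_assoc (C / 2), ← hkα]
    field_simp
  obtain ⟨D, hD⟩ := exists_uniform_limit_of_geometric
    (Real.rpow_lt_one (by norm_num) (by norm_num) hα) hstep (by positivity)
  have hGd : ∀ x ∈ u, HasDerivAt G (D x) x := fun x hx =>
    hasDerivAt_of_tendstoUniformlyOn isOpen_Ioo hD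
      (Eventually.of_forall fun n y _ => hAd n y) (fun y _ => hAlim y) hx
  have hDc : ContinuousOn D u :=
    hD.continuousOn (Eventually.of_forall fun n => (hQc n).continuousOn).frequently
  refine (contDiffOn_succ_iff_deriv_of_isOpen (n := 0) isOpen_Ioo).mpr
    ⟨fun x hx => (hGd x hx).differentiableAt.differentiableWithinAt, by simp, ?_⟩
  exact contDiffOn_zero.mpr (hDc.congr fun x hx => (hGd x hx).deriv)

/-- The local version needs a function continuous on the whole line, so `F` is restricted to a
compact window around each point and extended by its endpoint values. Dividing by 3 in the choice of
`r` keeps the window of radius `2r` inside the open interval. -/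
lemma contDiffOn_of_second_difference {F : ℝ → X} {a b C α : ℝ} (hα : 0 < α)
    (hF : ContinuousOn F (Ioo a b))
    (h2 : ∀ x k, x - k ∈ Ioo a b → x + k ∈ Ioo a b → 0 ≤ k →
      ‖F (x + k) + F (x - k) - (2 : ℝ) • F x‖ ≤ C * k ^ (1 + α)) :
    ContDiffOn ℝ 1 F (Ioo a b) := by
  refine contDiffOn_of_locally_contDiffOn fun h₀ hh₀ => ?_
  set r : ℝ := min (h₀ - a) (b - h₀) / 3 with hr
  have hm : 0 < min (h₀ - a) (b - h₀) := lt_min (sub_pos.mpr hh₀.1) (sub_pos.mpr hh₀.2)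
  have hr0 : 0 < r := by positivity
  have hra : 3 * r ≤ h₀ - a := by
    rw [hr, mul_div_cancel₀ _ (by norm_num)]
    exact min_le_left _ _
  have hrb : 3 * r ≤ b - h₀ := by
    rw [hr, mul_div_cancel₀ _ (by norm_num)]
    exact min_le_right _ _
  have hsub : Icc (h₀ - 2 * r) (h₀ + 2 * r) ⊆ Ioo a b := fun x hx =>
    ⟨by linarith [hx.1], by linarith [hx.2]⟩
  have hle : h₀ - 2 * r ≤ h₀ + 2 * r := by linarith
  set G : ℝ → X := IccExtend hle ((Icc (h₀ - 2 * r) (h₀ + 2 * r)).domRestrict F) with hG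
  have hGc : Continuous G := (hF.mono hsub).domRestrict.Icc_extend'
  have hGF : ∀ x ∈ Icc (h₀ - 2 * r) (h₀ + 2 * r), G x = F x := fun x hx =>
    IccExtend_of_mem hle _ hx
  have hloc := contDiffOn_of_second_difference_local hGc hr0 hα (h₀ := h₀) (C := C)
    fun x k hx1 hx2 hk => by
      rw [hGF _ hx1, hGF _ hx2, hGF x ⟨by linarith [hx1.1], by linarith [hx2.2]⟩]
      exact h2 x k (hsub hx1) (hsub hx2) hk
  refine ⟨Ioo (h₀ - r) (h₀ + r), isOpen_Ioo, ⟨by linarith, by linarith⟩, ?_⟩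
  refine (hloc.mono inter_subset_right).congr fun x hx => (hGF x ?_).symm
  exact ⟨by linarith [hx.2.1], by linarith [hx.2.2]⟩

end SecondDifferences

/-! ### Difference estimates for `C^{1+α}` functions -/

section HolderField

variable {E F G : Type*} [NormedAddCommGroup E] [NormedSpace ℝ E] [NormedAddCommGroup F]
  [NormedSpace ℝ F] [NormedAddCommGroup G] [NormedSpace ℝ G]

/-- A bounded Lipschitz function with second differences of order `1 + α`. -/
structure IsHolderField (K α : ℝ) (B : E → F) : Prop where
  norm_le : ∀ x, ‖B x‖ ≤ K
  lipschitz : ∀ x y, ‖B x - B y‖ ≤ K * ‖x - y‖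
  second : ∀ u v y, ‖B u + B v - (2 : ℝ) • B y‖
    ≤ K * ‖u + v - (2 : ℝ) • y‖ + K * (‖u - y‖ ^ (1 + α) + ‖v - y‖ ^ (1 + α))

lemma IsHolderField.prodMk {K α : ℝ} {B : E → F} {B' : E → G} (h : IsHolderField K α B)
    (h' : IsHolderField K α B') : IsHolderField K α fun x => (B x, B' x) :=
  ⟨fun x => norm_prod_le_iff.mpr ⟨h.norm_le x, h'.norm_le x⟩,
    fun x y => norm_prod_le_iff.mpr ⟨h.lipschitz x y, h'.lipschitz x y⟩,
    fun u v y => norm_prod_le_iff.mpr ⟨h.second u v y, h'.second u v y⟩⟩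

lemma IsHolderField.comp_fst {K α : ℝ} {B : E → F} (h : IsHolderField K α B) (hK : 0 ≤ K)
    (hα : 0 ≤ α) : IsHolderField K α fun p : E × G => B p.1 := by
  refine ⟨fun p => h.norm_le p.1, fun p q => (h.lipschitz _ _).trans
    (mul_le_mul_of_nonneg_left (norm_fst_le (p - q)) hK), fun u v y => (h.second _ _ _).trans ?_⟩
  have h1 : ‖u.1 + v.1 - (2 : ℝ) • y.1‖ ≤ ‖u + v - (2 : ℝ) • y‖ :=
    norm_fst_le (u + v - (2 : ℝ) • y)
  have h2 : ‖u.1 - y.1‖ ≤ ‖u - y‖ := norm_fst_le (u - y)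
  have h3 : ‖v.1 - y.1‖ ≤ ‖v - y‖ := norm_fst_le (v - y)
  gcongr

lemma HolderC1.norm_fderiv_le {α : ℝ≥0} (f : HolderC1 α E F) (x : E) :
    ‖fderiv ℝ (f : E → F) x‖ ≤ ‖f‖ := by
  have h1 : ‖fderiv ℝ (f : E → F) x‖ ≤ ⨆ x, ‖fderiv ℝ (f : E → F) x‖ :=
    le_ciSup f.isHolderC1.bdd_fderiv x
  have h2 : 0 ≤ ⨆ x, ‖(f : E → F) x‖ := Real.iSup_nonneg fun _ => norm_nonneg _
  have h3 : (0 : ℝ) ≤ nnHolderNorm α (fderiv ℝ (f : E → F)) := NNReal.coe_nonneg _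
  rw [HolderC1.norm_def, holderC1Norm]
  linarith

lemma HolderC1.norm_fderiv_sub_le {α : ℝ≥0} (f : HolderC1 α E F) (x y : E) :
    ‖fderiv ℝ (f : E → F) x - fderiv ℝ (f : E → F) y‖ ≤ ‖f‖ * ‖x - y‖ ^ (α : ℝ) := by
  have h := f.isHolderC1.holder_fderiv.holderWith.dist_le x y
  rw [dist_eq_norm, dist_eq_norm] at h
  refine h.trans (mul_le_mul_of_nonneg_right ?_ (by positivity))
  have h1 : 0 ≤ ⨆ x, ‖fderiv ℝ (f : E → F) x‖ := Real.iSup_nonneg fun _ => norm_nonneg _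
  have h2 : 0 ≤ ⨆ x, ‖(f : E → F) x‖ := Real.iSup_nonneg fun _ => norm_nonneg _
  rw [HolderC1.norm_def, holderC1Norm]
  linarith

/-- Mean value inequality on the closed ball of radius `‖y - x‖` about `x`, where the derivative
differs from its value at `x` by at most `‖f‖ ‖y - x‖^α`. -/
lemma HolderC1.norm_taylor_le {α : ℝ≥0} (f : HolderC1 α E F) (x y : E) :
    ‖(f : E → F) y - f x - fderiv ℝ (f : E → F) x (y - x)‖ ≤ ‖f‖ * ‖y - x‖ ^ (1 + (α : ℝ)) := by
  have h := (convex_closedBall x ‖y - x‖).norm_image_sub_le_of_norm_hasFDerivWithin_le'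
    (f := (f : E → F)) (f' := fderiv ℝ (f : E → F)) (φ := fderiv ℝ (f : E → F) x) (x := x) (y := y)
    (C := ‖f‖ * ‖y - x‖ ^ (α : ℝ))
    (fun z _ => (f.isHolderC1.contDiff.differentiable one_ne_zero z).hasFDerivAt.hasFDerivWithinAt)
    (fun z hz => (f.norm_fderiv_sub_le z x).trans (by
      rw [mem_closedBall_iff_norm] at hz
      gcongr))
    (Metric.mem_closedBall_self (norm_nonneg _)) (by rw [mem_closedBall_iff_norm])
  refine h.trans (le_of_eq ?_)
  rcases eq_or_ne (y - x) 0 with h0 | h0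
  · rw [h0, norm_zero, Real.zero_rpow (by linarith [α.coe_nonneg] : (0 : ℝ) < 1 + α).ne']
    ring
  · rw [Real.rpow_add (norm_pos_iff.mpr h0), Real.rpow_one]
    ring

/-- The second difference is the derivative at `y` applied to `u + v - 2y`, plus two Taylor
remainders based at `y`. -/
lemma HolderC1.isHolderField {α : ℝ≥0} (f : HolderC1 α E F) {K : ℝ} (hK : ‖f‖ ≤ K) :
    IsHolderField K α (f : E → F) := by
  refine ⟨fun x => (f.norm_apply_le x).trans hK, fun x y => ?_, fun u v y => ?_⟩
  · exact convex_univ.norm_image_sub_le_of_norm_fderiv_le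
      (fun z _ => f.isHolderC1.contDiff.differentiable one_ne_zero z)
      (fun z _ => (f.norm_fderiv_le z).trans hK) (mem_univ y) (mem_univ x)
  · have e : (f : E → F) u + f v - (2 : ℝ) • f y
        = fderiv ℝ (f : E → F) y (u + v - (2 : ℝ) • y)
          + ((f u - f y - fderiv ℝ (f : E → F) y (u - y))
            + (f v - f y - fderiv ℝ (f : E → F) y (v - y))) := by
      have : u + v - (2 : ℝ) • y = (u - y) + (v - y) := by module
      rw [this, map_add]
      module
    rw [e]
    refine (norm_add_le _ _).trans (add_le_add ?_ ((norm_add_le _ _).trans ?_))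
    · exact (ContinuousLinearMap.le_opNorm _ _).trans
        (mul_le_mul_of_nonneg_right ((f.norm_fderiv_le y).trans hK) (norm_nonneg _))
    · rw [mul_add]
      refine add_le_add ((f.norm_taylor_le y u).trans ?_) ((f.norm_taylor_le y v).trans ?_) <;>
      gcongr

end HolderField

/-! ### Discrete Gronwall estimates in the parameter -/

section DiscreteGronwall

variable {E : Type*} [NormedAddCommGroup E] [NormedSpace ℝ E]

/-- The explicit Euler scheme with step `τ` and field `B₀ + h B₁`. -/
def IsEuler (B₀ B₁ : ℕ → E → E) (τ h : ℝ) (y : ℕ → E) : Prop :=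
  ∀ k, y (k + 1) = y k + τ • (B₀ k (y k) + h • B₁ k (y k))

variable {B₀ B₁ : ℕ → E → E} {K α τ : ℝ}

lemma one_add_mul_le_exp {c : ℝ} (a : ℝ) (h : c ≤ a) : 1 + c ≤ Real.exp a := by
  linarith [Real.add_one_le_exp a]

lemma norm_euler_sub_le (hB₀ : ∀ k, IsHolderField K α (B₀ k)) (hB₁ : ∀ k, IsHolderField K α (B₁ k))
    (hK : 0 ≤ K) (hτ : 0 ≤ τ) {h h' : ℝ} (hh : |h| ≤ 1) {u v : ℕ → E}
    (hu : IsEuler B₀ B₁ τ h u) (hv : IsEuler B₀ B₁ τ h' v) (h0 : u 0 = v 0) (k : ℕ) :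
    ‖u k - v k‖ ≤ |h - h'| * Real.exp (2 * K * (k * τ)) := by
  -- The `-1` absorbs the inhomogeneous term of the recursion: `(1 + 2Kτ)(X - 1) + Kτ ≤ e^{2Kτ} X -
  -- 1`.
  suffices H : ‖u k - v k‖ ≤ |h - h'| * (Real.exp (2 * K * (k * τ)) - 1) from
    H.trans (mul_le_mul_of_nonneg_left (by linarith) (abs_nonneg _))
  induction k with
  | zero => simp [h0]
  | succ k ih =>
    have e : u (k + 1) - v (k + 1) = (u k - v k) + τ • ((B₀ k (u k) - B₀ k (v k))
        + h • (B₁ k (u k) - B₁ k (v k)) + (h - h') • B₁ k (v k)) := by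
      rw [hu k, hv k]
      module
    have h1 : ‖(B₀ k (u k) - B₀ k (v k)) + h • (B₁ k (u k) - B₁ k (v k))
        + (h - h') • B₁ k (v k)‖ ≤ K * ‖u k - v k‖ + 1 * (K * ‖u k - v k‖) + |h - h'| * K := by
      refine (norm_add₃_le).trans (add_le_add (add_le_add ((hB₀ k).lipschitz _ _) ?_) ?_)
      · rw [norm_smul]
        exact mul_le_mul hh ((hB₁ k).lipschitz _ _) (norm_nonneg _) zero_le_one
      · rw [norm_smul]
        exact mul_le_mul_of_nonneg_left ((hB₁ k).norm_le _) (abs_nonneg _)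
    have h2 : ‖u (k + 1) - v (k + 1)‖ ≤ (1 + 2 * K * τ) * ‖u k - v k‖ + τ * (|h - h'| * K) := by
      rw [e]
      refine (norm_add_le _ _).trans ?_
      rw [norm_smul, Real.norm_of_nonneg hτ]
      nlinarith [mul_le_mul_of_nonneg_left h1 hτ]
    have h3 : Real.exp (2 * K * ((k + 1 : ℕ) * τ))
        = Real.exp (2 * K * τ) * Real.exp (2 * K * (k * τ)) := by
      rw [← Real.exp_add]
      push_cast
      ring_nf
    set X := Real.exp (2 * K * (k * τ)) with hX
    have h4 : (1 + 2 * K * τ) * X ≤ Real.exp (2 * K * τ) * X :=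
      mul_le_mul_of_nonneg_right (one_add_mul_le_exp _ le_rfl) (Real.exp_pos _).le
    have hKτ : 0 ≤ K * τ := mul_nonneg hK hτ
    have ha := abs_nonneg (h - h')
    rw [h3]
    calc ‖u (k + 1) - v (k + 1)‖
        ≤ (1 + 2 * K * τ) * (|h - h'| * (X - 1)) + τ * (|h - h'| * K) :=
          h2.trans (add_le_add_left (mul_le_mul_of_nonneg_left ih (by linarith)) _)
      _ = |h - h'| * ((1 + 2 * K * τ) * X - 1 - K * τ) := by ring
      _ ≤ |h - h'| * (Real.exp (2 * K * τ) * X - 1) :=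
          mul_le_mul_of_nonneg_left (by linarith) ha

/-- Only `k` needs the exact exponent. On the exponential factor `X ≥ 1` the exponent is rounded up
to 2, so the growth rates do not depend on `α`. -/
lemma rpow_one_add_le {a k X : ℝ} (ha : 0 ≤ a) (hk : 0 ≤ k) (hX : 1 ≤ X) (hα : 0 ≤ α) (hα1 : α ≤ 1)
    (h : a ≤ k * X) : a ^ (1 + α) ≤ k ^ (1 + α) * X ^ 2 := by
  calc a ^ (1 + α) ≤ (k * X) ^ (1 + α) := Real.rpow_le_rpow ha h (by linarith)
    _ = k ^ (1 + α) * X ^ (1 + α) := Real.mul_rpow hk (by linarith)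
    _ ≤ k ^ (1 + α) * X ^ (2 : ℝ) := by
        gcongr
        · linarith
    _ = k ^ (1 + α) * X ^ 2 := by rw [Real.rpow_two]

lemma sq_le_rpow_one_add {k : ℝ} (hk : 0 ≤ k) (hk1 : k ≤ 1) (hα : 0 ≤ α) (hα1 : α ≤ 1) :
    k ^ 2 ≤ k ^ (1 + α) := by
  rw [← Real.rpow_two]
  rcases hk.eq_or_lt with rfl | hk
  · rw [Real.zero_rpow (by norm_num), Real.zero_rpow (by linarith)]
  · exact Real.rpow_le_rpow_of_exponent_ge hk hk1 (by linarith)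

lemma norm_euler_second_le (hB₀ : ∀ k, IsHolderField K α (B₀ k))
    (hB₁ : ∀ k, IsHolderField K α (B₁ k)) (hK : 0 ≤ K) (hτ : 0 ≤ τ) (hα : 0 ≤ α) (hα1 : α ≤ 1)
    {h ρ : ℝ} (hρ : 0 ≤ ρ) (hρ1 : ρ ≤ 1) (hh : |h| ≤ 1) (hp : |h + ρ| ≤ 1) (hm : |h - ρ| ≤ 1)
    {u v y : ℕ → E} (hu : IsEuler B₀ B₁ τ (h + ρ) u) (hv : IsEuler B₀ B₁ τ (h - ρ) v)
    (hy : IsEuler B₀ B₁ τ h y) (hu0 : u 0 = y 0) (hv0 : v 0 = y 0) (k : ℕ) :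
    ‖u k + v k - (2 : ℝ) • y k‖ ≤ 3 * ρ ^ (1 + α) * Real.exp (4 * K * (k * τ)) := by
  set κ := ρ ^ (1 + α) with hκ
  have hκ0 : 0 ≤ κ := by positivity
  -- With `Y = e^{2Kkτ}`, the second differences satisfy `s_{k+1} ≤ (1 + 2Kτ) s_k + 6Kτ κ Y²`, and
  -- `3κ(Y² - 1)` is a supersolution. In the 6, two units come from the Hölder remainders of each of
  -- `B₀` and `B₁`, two from the cross term.
  suffices H : ‖u k + v k - (2 : ℝ) • y k‖ ≤ 3 * κ * (Real.exp (4 * K * (k * τ)) - 1) from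
    H.trans (mul_le_mul_of_nonneg_left (by linarith) (by positivity))
  induction k with
  | zero => simp [hu0, hv0, two_smul]
  | succ k ih =>
    set Y := Real.exp (2 * K * (k * τ)) with hY
    have hY1 : 1 ≤ Y := Real.one_le_exp (by positivity)
    have hY2 : Real.exp (4 * K * (k * τ)) = Y ^ 2 := by
      rw [hY, ← Real.exp_nat_mul]
      congr 1
      push_cast
      ring
    have du : ‖u k - y k‖ ≤ ρ * Y := by
      have := norm_euler_sub_le hB₀ hB₁ hK hτ hp hu hy hu0 k
      rwa [add_sub_cancel_left, abs_of_nonneg hρ] at this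
    have dv : ‖v k - y k‖ ≤ ρ * Y := by
      have := norm_euler_sub_le hB₀ hB₁ hK hτ hm hv hy hv0 k
      rwa [sub_sub_cancel_left, abs_neg, abs_of_nonneg hρ] at this
    have duv : ‖u k - v k‖ ≤ 2 * (ρ * Y) := by
      rw [← sub_sub_sub_cancel_right (u k) (v k) (y k)]
      exact (norm_sub_le _ _).trans (by linarith)
    have pu := rpow_one_add_le (norm_nonneg _) hρ hY1 hα hα1 du
    have pv := rpow_one_add_le (norm_nonneg _) hρ hY1 hα hα1 dv
    have hsq := sq_le_rpow_one_add hρ hρ1 hα hα1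
    rw [← hκ] at pu pv hsq
    set s := ‖u k + v k - (2 : ℝ) • y k‖ with hs
    have e : u (k + 1) + v (k + 1) - (2 : ℝ) • y (k + 1)
        = (u k + v k - (2 : ℝ) • y k) + τ • ((B₀ k (u k) + B₀ k (v k) - (2 : ℝ) • B₀ k (y k))
          + h • (B₁ k (u k) + B₁ k (v k) - (2 : ℝ) • B₁ k (y k))
          + ρ • (B₁ k (u k) - B₁ k (v k))) := by
      rw [hu k, hv k, hy k]
      module
    have hsec : K * s + K * (‖u k - y k‖ ^ (1 + α) + ‖v k - y k‖ ^ (1 + α))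
        ≤ K * s + K * (2 * (κ * Y ^ 2)) := by
      gcongr
      linarith
    have h1 : ‖(B₀ k (u k) + B₀ k (v k) - (2 : ℝ) • B₀ k (y k))
        + h • (B₁ k (u k) + B₁ k (v k) - (2 : ℝ) • B₁ k (y k)) + ρ • (B₁ k (u k) - B₁ k (v k))‖
        ≤ (K * s + K * (2 * (κ * Y ^ 2))) + 1 * (K * s + K * (2 * (κ * Y ^ 2)))
          + ρ * (K * (2 * (ρ * Y))) := by
      refine (norm_add₃_le).trans (add_le_add (add_le_add (((hB₀ k).second _ _ _).trans hsec) ?_)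
        ?_)
      · rw [norm_smul]
        exact mul_le_mul hh (((hB₁ k).second _ _ _).trans hsec) (norm_nonneg _) zero_le_one
      · rw [norm_smul, Real.norm_of_nonneg hρ]
        exact mul_le_mul_of_nonneg_left (((hB₁ k).lipschitz _ _).trans
          (mul_le_mul_of_nonneg_left duv hK)) hρ
    -- The cross term, due to `h` multiplying `B₁`, is of order `ρ²`; as `ρ ≤ 1` and `α ≤ 1`, it is
    -- absorbed into `ρ^{1+α}`.
    have h2 : ρ * (K * (2 * (ρ * Y))) ≤ 2 * K * (κ * Y ^ 2) := by
      have : ρ ^ 2 * Y ≤ κ * Y ^ 2 :=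
        mul_le_mul hsq (by nlinarith) (by linarith) hκ0
      nlinarith [mul_le_mul_of_nonneg_left this hK]
    have h3 : ‖u (k + 1) + v (k + 1) - (2 : ℝ) • y (k + 1)‖
        ≤ (1 + 2 * K * τ) * s + 6 * (K * τ) * (κ * Y ^ 2) := by
      rw [e]
      refine (norm_add_le _ _).trans ?_
      rw [norm_smul, Real.norm_of_nonneg hτ]
      nlinarith [mul_le_mul_of_nonneg_left (h1.trans (add_le_add_right h2 _)) hτ]
    have h4 : Real.exp (4 * K * ((k + 1 : ℕ) * τ)) = Real.exp (4 * K * τ) * Y ^ 2 := by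
      rw [← hY2, ← Real.exp_add]
      push_cast
      ring_nf
    have h5 : (1 + 4 * K * τ) * Y ^ 2 ≤ Real.exp (4 * K * τ) * Y ^ 2 :=
      mul_le_mul_of_nonneg_right (one_add_mul_le_exp _ le_rfl) (by positivity)
    have hKτ : 0 ≤ K * τ := mul_nonneg hK hτ
    rw [hY2] at ih
    rw [h4]
    calc ‖u (k + 1) + v (k + 1) - (2 : ℝ) • y (k + 1)‖
        ≤ (1 + 2 * K * τ) * (3 * κ * (Y ^ 2 - 1)) + 6 * (K * τ) * (κ * Y ^ 2) :=
          h3.trans (add_le_add_left (mul_le_mul_of_nonneg_left ih (by linarith)) _)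
      _ = 3 * κ * ((1 + 4 * K * τ) * Y ^ 2 - 1 - 2 * (K * τ)) := by ring
      _ ≤ 3 * κ * (Real.exp (4 * K * τ) * Y ^ 2 - 1) :=
          mul_le_mul_of_nonneg_left (by linarith) (by positivity)

end DiscreteGronwall

/-! ### Second differences of `f(x) e^z` -/

section Observable

variable {E : Type*} [NormedAddCommGroup E] [NormedSpace ℝ E]

lemma abs_exp_sub_le {a z L : ℝ} (ha : Real.exp a ≤ L) (hz : Real.exp z ≤ L) :
    |Real.exp a - Real.exp z| ≤ L * |a - z| := by
  wlog hza : z ≤ a generalizing a z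
  · rw [abs_sub_comm, abs_sub_comm a]
    exact this hz ha (not_le.mp hza).le
  have h1 : 1 + (z - a) ≤ Real.exp (z - a) := one_add_mul_le_exp _ le_rfl
  have h2 : Real.exp z = Real.exp a * Real.exp (z - a) := by
    rw [← Real.exp_add]
    ring_nf
  rw [abs_of_nonneg (sub_nonneg.mpr (Real.exp_le_exp.mpr hza)), abs_of_nonneg (sub_nonneg.mpr hza)]
  have h3 : Real.exp a - Real.exp z ≤ Real.exp a * (a - z) := by
    rw [h2]
    nlinarith [Real.exp_pos a]
  exact h3.trans (mul_le_mul_of_nonneg_right ha (sub_nonneg.mpr hza))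

/-- By convexity `e^z (a - z) ≤ e^a - e^z ≤ e^a (a - z)`, so the remainder lies between 0 and `(e^a
- e^z)(a - z)`. -/
lemma abs_exp_taylor_le {a z L : ℝ} (ha : Real.exp a ≤ L) (hz : Real.exp z ≤ L) :
    |Real.exp a - Real.exp z - Real.exp z * (a - z)| ≤ L * |a - z| ^ 2 := by
  have key : ∀ p q : ℝ, Real.exp q * (p - q) ≤ Real.exp p - Real.exp q := fun p q => by
    have h1 : 1 + (p - q) ≤ Real.exp (p - q) := one_add_mul_le_exp _ le_rfl
    have h2 : Real.exp p = Real.exp q * Real.exp (p - q) := by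
      rw [← Real.exp_add]
      ring_nf
    rw [h2]
    nlinarith [Real.exp_pos q]
  have h1 := key a z
  have h2 := key z a
  rw [abs_of_nonneg (by linarith)]
  calc Real.exp a - Real.exp z - Real.exp z * (a - z)
      ≤ (Real.exp a - Real.exp z) * (a - z) := by linarith
    _ ≤ |Real.exp a - Real.exp z| * |a - z| := by
        rw [← abs_mul]
        exact le_abs_self _
    _ ≤ L * |a - z| * |a - z| :=
        mul_le_mul_of_nonneg_right (abs_exp_sub_le ha hz) (abs_nonneg _)
    _ = L * |a - z| ^ 2 := by ring

variable {α N L κ ρ : ℝ} {f : E → ℝ}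

lemma abs_obs_sub_le (hf : IsHolderField N α f) (hN : 0 ≤ N) {p q : E × ℝ}
    (hp : Real.exp p.2 ≤ L) (hq : Real.exp q.2 ≤ L) :
    |f p.1 * Real.exp p.2 - f q.1 * Real.exp q.2| ≤ 2 * N * L * ‖p - q‖ := by
  have hL : 0 ≤ L := (Real.exp_pos _).le.trans hp
  have e : f p.1 * Real.exp p.2 - f q.1 * Real.exp q.2
      = (f p.1 - f q.1) * Real.exp p.2 + f q.1 * (Real.exp p.2 - Real.exp q.2) := by ring
  have n1 : ‖p.1 - q.1‖ ≤ ‖p - q‖ := norm_fst_le (p - q)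
  have n2 : |p.2 - q.2| ≤ ‖p - q‖ := norm_snd_le (p - q)
  have a1 : |(f p.1 - f q.1) * Real.exp p.2| ≤ (N * ‖p - q‖) * L := by
    rw [abs_mul, Real.abs_exp]
    exact mul_le_mul ((hf.lipschitz _ _).trans (mul_le_mul_of_nonneg_left n1 hN)) hp
      (Real.exp_pos _).le (by positivity)
  have a2 : |f q.1 * (Real.exp p.2 - Real.exp q.2)| ≤ N * (L * ‖p - q‖) := by
    rw [abs_mul]
    exact mul_le_mul (hf.norm_le _) ((abs_exp_sub_le hp hq).trans
      (mul_le_mul_of_nonneg_left n2 hL)) (abs_nonneg _) hN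
  rw [e]
  refine (abs_add_le _ _).trans ((add_le_add a1 a2).trans (le_of_eq ?_))
  ring

/-- Second differences of `(x, z) ↦ f(x) e^z`. -/
lemma abs_obs_second_le (hf : IsHolderField N α f) (hN : 0 ≤ N) (hα : 0 ≤ α) (hα1 : α ≤ 1)
    (hL : 1 ≤ L) (hρ : 0 ≤ ρ) (hρ1 : ρ ≤ 1) {u v y : E × ℝ} (hu : Real.exp u.2 ≤ L)
    (hv : Real.exp v.2 ≤ L) (hy : Real.exp y.2 ≤ L) (du : ‖u - y‖ ≤ ρ * L) (dv : ‖v - y‖ ≤ ρ * L)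
    (ds : ‖u + v - (2 : ℝ) • y‖ ≤ 3 * ρ ^ (1 + α) * L ^ 2) :
    |f u.1 * Real.exp u.2 + f v.1 * Real.exp v.2 - 2 * (f y.1 * Real.exp y.2)|
      ≤ 12 * N * L ^ 3 * ρ ^ (1 + α) := by
  have hL0 : 0 ≤ L := zero_le_one.trans hL
  set κ := ρ ^ (1 + α) with hκ
  have hκ0 : 0 ≤ κ := by positivity
  have hsq : ρ ^ 2 ≤ κ := sq_le_rpow_one_add hρ hρ1 hα hα1
  have u1 : ‖u.1 - y.1‖ ≤ ρ * L := (norm_fst_le (u - y)).trans du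
  have u2 : |u.2 - y.2| ≤ ρ * L := (norm_snd_le (u - y)).trans du
  have v1 : ‖v.1 - y.1‖ ≤ ρ * L := (norm_fst_le (v - y)).trans dv
  have v2 : |v.2 - y.2| ≤ ρ * L := (norm_snd_le (v - y)).trans dv
  have s1 : ‖u.1 + v.1 - (2 : ℝ) • y.1‖ ≤ 3 * κ * L ^ 2 :=
    (norm_fst_le (u + v - (2 : ℝ) • y)).trans ds
  have s2 : |u.2 + v.2 - 2 * y.2| ≤ 3 * κ * L ^ 2 :=
    (norm_snd_le (u + v - (2 : ℝ) • y)).trans ds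
  have hρL : (ρ * L) ^ 2 ≤ κ * L ^ 2 := by
    rw [mul_pow]
    exact mul_le_mul_of_nonneg_right hsq (by positivity)
  have fs : |f u.1 + f v.1 - 2 * f y.1| ≤ 5 * N * κ * L ^ 2 := by
    have h1 := hf.second u.1 v.1 y.1
    have h2 := rpow_one_add_le (norm_nonneg _) hρ hL hα hα1 u1
    have h3 := rpow_one_add_le (norm_nonneg _) hρ hL hα hα1 v1
    rw [← hκ] at h2 h3
    refine h1.trans ?_
    nlinarith [mul_le_mul_of_nonneg_left s1 hN, mul_le_mul_of_nonneg_left (add_le_add h2 h3) hN]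
  have es : |Real.exp u.2 + Real.exp v.2 - 2 * Real.exp y.2| ≤ 5 * κ * L ^ 3 := by
    have h1 := abs_exp_taylor_le hu hy
    have h2 := abs_exp_taylor_le hv hy
    have h3 : |Real.exp y.2 * (u.2 + v.2 - 2 * y.2)| ≤ L * (3 * κ * L ^ 2) := by
      rw [abs_mul, Real.abs_exp]
      exact mul_le_mul hy s2 (abs_nonneg _) hL0
    have h4 : L * |u.2 - y.2| ^ 2 ≤ L * (κ * L ^ 2) :=
      mul_le_mul_of_nonneg_left ((pow_le_pow_left₀ (abs_nonneg _) u2 2).trans hρL) hL0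
    have h5 : L * |v.2 - y.2| ^ 2 ≤ L * (κ * L ^ 2) :=
      mul_le_mul_of_nonneg_left ((pow_le_pow_left₀ (abs_nonneg _) v2 2).trans hρL) hL0
    have e : Real.exp u.2 + Real.exp v.2 - 2 * Real.exp y.2
        = (Real.exp u.2 - Real.exp y.2 - Real.exp y.2 * (u.2 - y.2))
          + (Real.exp v.2 - Real.exp y.2 - Real.exp y.2 * (v.2 - y.2))
          + Real.exp y.2 * (u.2 + v.2 - 2 * y.2) := by ring
    rw [e]
    refine (abs_add_three _ _ _).trans ?_
    linarith
  have cross : ∀ p : E × ℝ, Real.exp p.2 ≤ L → ‖p.1 - y.1‖ ≤ ρ * L → |p.2 - y.2| ≤ ρ * L →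
      |(f p.1 - f y.1) * (Real.exp p.2 - Real.exp y.2)| ≤ N * L ^ 3 * κ := by
    intro p hp p1 p2
    have h1 : |f p.1 - f y.1| ≤ N * (ρ * L) :=
      (hf.lipschitz _ _).trans (mul_le_mul_of_nonneg_left p1 hN)
    have h2 : |Real.exp p.2 - Real.exp y.2| ≤ L * (ρ * L) :=
      (abs_exp_sub_le hp hy).trans (mul_le_mul_of_nonneg_left p2 hL0)
    rw [abs_mul]
    refine (mul_le_mul h1 h2 (abs_nonneg _) (by positivity)).trans ?_
    nlinarith [mul_le_mul_of_nonneg_left hρL (mul_nonneg hN hL0)]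
  -- Discrete product rule at `y`. The constant 12 is `5 + 5` from the second differences of the two
  -- factors plus 1 from each product of first differences.
  have e : f u.1 * Real.exp u.2 + f v.1 * Real.exp v.2 - 2 * (f y.1 * Real.exp y.2)
      = Real.exp y.2 * (f u.1 + f v.1 - 2 * f y.1)
        + f y.1 * (Real.exp u.2 + Real.exp v.2 - 2 * Real.exp y.2)
        + ((f u.1 - f y.1) * (Real.exp u.2 - Real.exp y.2)
          + (f v.1 - f y.1) * (Real.exp v.2 - Real.exp y.2)) := by ring
  have t1 : |Real.exp y.2 * (f u.1 + f v.1 - 2 * f y.1)| ≤ L * (5 * N * κ * L ^ 2) := by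
    rw [abs_mul, Real.abs_exp]
    exact mul_le_mul hy fs (abs_nonneg _) hL0
  have t2 : |f y.1 * (Real.exp u.2 + Real.exp v.2 - 2 * Real.exp y.2)| ≤ N * (5 * κ * L ^ 3) := by
    rw [abs_mul]
    exact mul_le_mul (hf.norm_le _) es (abs_nonneg _) hN
  rw [e]
  refine (abs_add_three _ _ _).trans ((add_le_add (add_le_add t1 t2)
    ((abs_add_le _ _).trans (add_le_add (cross u hu u1 u2) (cross v hv v1 v2)))).trans
      (le_of_eq ?_))
  ring

end Observable

/-! ### Regularity of the given coefficients -/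

section Coefficients

variable {d : ℕ} {α : ℝ≥0}

lemma continuous_uncurry_holderC1 {F : Type*} [NormedAddCommGroup F] [NormedSpace ℝ F]
    (b : ℝ≥0 →ᵇ HolderC1 α (Rn d) F) :
    Continuous (Function.uncurry fun t x => (b t : Rn d → F) x) := by
  rw [continuous_iff_continuousAt]
  rintro ⟨t, x⟩
  have h1 : Tendsto (fun p : ℝ≥0 × Rn d => (b t : Rn d → F) p.2) (𝓝 (t, x)) (𝓝 (b t x)) :=
    ((b t).isHolderC1.contDiff.continuous.comp continuous_snd).continuousAt
  have h2 : Tendsto (fun p : ℝ≥0 × Rn d => (b p.1 - b t : HolderC1 α (Rn d) F) p.2) (𝓝 (t, x))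
      (𝓝 0) := by
    refine squeeze_zero_norm (fun p => HolderC1.norm_apply_le _ _) ?_
    have h : Continuous fun p : ℝ≥0 × Rn d => ‖b p.1 - b t‖ := by fun_prop
    simpa using h.tendsto (t, x)
  have h3 := h2.add h1
  rw [zero_add] at h3
  exact h3.congr fun p => sub_add_cancel ((b p.1 : Rn d → F) p.2) ((b t : Rn d → F) p.2)

lemma exists_modulus {F : Type*} [NormedAddCommGroup F] [NormedSpace ℝ F]
    (b : ℝ≥0 →ᵇ HolderC1 α (Rn d) F) (T : ℝ≥0) {δ : ℝ} (hδ : 0 < δ) :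
    ∃ η > 0, ∀ s ≤ T, ∀ t ≤ T, dist s t ≤ η → ∀ x,
      ‖(b s : Rn d → F) x - (b t : Rn d → F) x‖ ≤ δ := by
  have h := (isCompact_Icc (a := (0 : ℝ≥0)) (b := T)).uniformContinuousOn_of_continuous
    b.continuous.continuousOn
  rw [Metric.uniformContinuousOn_iff_le] at h
  obtain ⟨η, hη, h⟩ := h δ hδ
  refine ⟨η, hη, fun s hs t ht hst x => ?_⟩
  have h1 := h s ⟨zero_le, hs⟩ t ⟨zero_le, ht⟩ hst
  rw [dist_eq_norm] at h1
  exact (HolderC1.norm_apply_le (b s - b t) x).trans h1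

lemma regularCoeff_of_holderC1 (b : ℝ≥0 →ᵇ HolderC1 α (Rn d) (Rn d))
    (w : ℝ≥0 →ᵇ HolderC1 α (Rn d) ℝ) {K : ℝ} (hb : ‖b‖ ≤ K) (hw : ‖w‖ ≤ K) :
    RegularCoeff (fun t x => (b t : Rn d → Rn d) x) (fun t x => (w t : Rn d → ℝ) x) K where
  continuous_b := continuous_uncurry_holderC1 b
  continuous_w := continuous_uncurry_holderC1 w
  contDiff_b t := (b t).isHolderC1.contDiff
  contDiff_w t := (w t).isHolderC1.contDiff
  norm_b_le t x := ((b t).norm_apply_le x).trans ((b.norm_coe_le_norm t).trans hb)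
  abs_w_le t x := ((w t).norm_apply_le x).trans ((w.norm_coe_le_norm t).trans hw)
  fderiv_b_le t x := ((b t).norm_fderiv_le x).trans ((b.norm_coe_le_norm t).trans hb)
  fderiv_w_le t x := ((w t).norm_fderiv_le x).trans ((w.norm_coe_le_norm t).trans hw)
  modulus T δ hδ := by
    obtain ⟨η₁, h₁, H₁⟩ := exists_modulus b T hδ
    obtain ⟨η₂, h₂, H₂⟩ := exists_modulus w T hδ
    exact ⟨min η₁ η₂, lt_min h₁ h₂, fun s hs t ht hst x =>
      ⟨H₁ s hs t ht (hst.trans (min_le_left _ _)) x,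
        H₂ s hs t ht (hst.trans (min_le_right _ _)) x⟩⟩

lemma HolderC1.isC1Bounded (f : HolderC1 α (Rn d) ℝ) : IsC1Bounded ‖f‖ (f : Rn d → ℝ) :=
  ⟨f.isHolderC1.contDiff, f.norm_apply_le, f.norm_fderiv_le⟩

end Coefficients

/-! ### Bounds for the family of solutions, uniform in the step size -/

section Family

variable {d : ℕ} {α : ℝ≥0} (b₀ b₁ : ℝ≥0 →ᵇ HolderC1 α (Rn d) (Rn d))
  (w₀ w₁ : ℝ≥0 →ᵇ HolderC1 α (Rn d) ℝ)

/-- The vector field `b₀ + h b₁`. -/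
def driftAt (h : ℝ) (t : ℝ≥0) (x : Rn d) : Rn d := b₀ t x + h • b₁ t x

/-- The growth rate `w₀ + h w₁`. -/
def rateAt (h : ℝ) (t : ℝ≥0) (x : Rn d) : ℝ := w₀ t x + h * w₁ t x

/-- A common bound for the norms of the coefficients. -/
def coeffBound : ℝ := ‖b₀‖ + ‖b₁‖ + ‖w₀‖ + ‖w₁‖ + 1

/-- The summand 1 keeps the bound positive even when all coefficients vanish, as required for `g >
0`. -/
lemma coeffBound_pos : 0 < coeffBound b₀ b₁ w₀ w₁ := by
  unfold coeffBound
  positivity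

lemma norm_add_smul_le {Y : Type*} [NormedAddCommGroup Y] [NormedSpace ℝ Y] (u v : Y) {h : ℝ}
    (hh : |h| ≤ 1) : ‖u + h • v‖ ≤ ‖u‖ + ‖v‖ := by
  refine (norm_add_le _ _).trans (add_le_add_right ?_ _)
  rw [norm_smul]
  exact mul_le_of_le_one_left (norm_nonneg _) hh

lemma regularCoeff_family {h : ℝ} (hh : |h| ≤ 1) :
    RegularCoeff (driftAt b₀ b₁ h) (rateAt w₀ w₁ h) (coeffBound b₀ b₁ w₀ w₁) := by
  refine regularCoeff_of_holderC1 (b₀ + h • b₁) (w₀ + h • w₁)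
    ((norm_add_smul_le b₀ b₁ hh).trans ?_) ((norm_add_smul_le w₀ w₁ hh).trans ?_)
  · unfold coeffBound
    linarith [norm_nonneg w₀, norm_nonneg w₁]
  · unfold coeffBound
    linarith [norm_nonneg b₀, norm_nonneg b₁]

/-- The combined field `(b, w)` on `ℝ^d × ℝ`. -/
def phaseField (b : ℝ≥0 →ᵇ HolderC1 α (Rn d) (Rn d)) (w : ℝ≥0 →ᵇ HolderC1 α (Rn d) ℝ) (τ : ℝ≥0)
    (k : ℕ) (p : Rn d × ℝ) : Rn d × ℝ :=
  (b (k * τ) p.1, w (k * τ) p.1)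

lemma isHolderField_phaseField (b : ℝ≥0 →ᵇ HolderC1 α (Rn d) (Rn d))
    (w : ℝ≥0 →ᵇ HolderC1 α (Rn d) ℝ) {K : ℝ} (hb : ‖b‖ ≤ K) (hw : ‖w‖ ≤ K) (τ : ℝ≥0) (k : ℕ) :
    IsHolderField K α (phaseField b w τ k) :=
  (((b (k * τ)).isHolderField ((b.norm_coe_le_norm _).trans hb)).prodMk
    ((w (k * τ)).isHolderField ((w.norm_coe_le_norm _).trans hw))).comp_fst
      ((norm_nonneg _).trans hb) α.coe_nonneg

lemma isHolderField_phaseField_zero (τ : ℝ≥0) (k : ℕ) :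
    IsHolderField (coeffBound b₀ b₁ w₀ w₁) α (phaseField b₀ w₀ τ k) := by
  refine isHolderField_phaseField b₀ w₀ ?_ ?_ τ k <;> unfold coeffBound <;>
    linarith [norm_nonneg b₀, norm_nonneg b₁, norm_nonneg w₀, norm_nonneg w₁]

lemma isHolderField_phaseField_one (τ : ℝ≥0) (k : ℕ) :
    IsHolderField (coeffBound b₀ b₁ w₀ w₁) α (phaseField b₁ w₁ τ k) := by
  refine isHolderField_phaseField b₁ w₁ ?_ ?_ τ k <;> unfold coeffBound <;>
    linarith [norm_nonneg b₀, norm_nonneg b₁, norm_nonneg w₀, norm_nonneg w₁]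

/-- Treating position and exponent as one state of a scheme affine in `h` gives both the same
difference estimates at once. -/
lemma isEuler_eulerState (h : ℝ) (τ : ℝ≥0) (x : Rn d) :
    IsEuler (phaseField b₀ w₀ τ) (phaseField b₁ w₁ τ) τ h
      (fun k => eulerState (driftAt b₀ b₁ h) (rateAt w₀ w₁ h) τ k x) :=
  fun _ => rfl

variable {b₀ b₁ w₀ w₁}

/-- The rate `K` is relaxed to `2K` so that one number `L = e^{2Kkτ}` bounds both the exponential
weights and the spread of the states per unit of `ρ`. -/
lemma exp_eulerState_le {h : ℝ} (hh : |h| ≤ 1) (τ : ℝ≥0) (k : ℕ) (x : Rn d) :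
    Real.exp (eulerState (driftAt b₀ b₁ h) (rateAt w₀ w₁ h) τ k x).2
      ≤ Real.exp (2 * coeffBound b₀ b₁ w₀ w₁ * (k * τ)) := by
  refine Real.exp_le_exp.mpr ((le_abs_self _).trans
    (((regularCoeff_family b₀ b₁ w₀ w₁ hh).abs_eulerState_snd_le τ k x).trans ?_))
  have h0 : 0 ≤ coeffBound b₀ b₁ w₀ w₁ * (k * τ) :=
    mul_nonneg (coeffBound_pos b₀ b₁ w₀ w₁).le (by positivity)
  linarith

lemma abs_eulerObs_sub_le {h h' : ℝ} (hh : |h| ≤ 1) (hh' : |h'| ≤ 1) (τ : ℝ≥0) (k : ℕ)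
    (f : HolderC1 α (Rn d) ℝ) (x : Rn d) :
    |eulerObs (driftAt b₀ b₁ h) (rateAt w₀ w₁ h) τ k f x
        - eulerObs (driftAt b₀ b₁ h') (rateAt w₀ w₁ h') τ k f x|
      ≤ 2 * ‖f‖ * Real.exp (2 * coeffBound b₀ b₁ w₀ w₁ * (k * τ)) ^ 2 * |h - h'| := by
  have d1 := norm_euler_sub_le (isHolderField_phaseField_zero b₀ b₁ w₀ w₁ τ)
    (isHolderField_phaseField_one b₀ b₁ w₀ w₁ τ) (coeffBound_pos b₀ b₁ w₀ w₁).le τ.coe_nonneg hh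
    (isEuler_eulerState b₀ b₁ w₀ w₁ h τ x) (isEuler_eulerState b₀ b₁ w₀ w₁ h' τ x) rfl k
  refine (abs_obs_sub_le (f.isHolderField le_rfl) (norm_nonneg f) (exp_eulerState_le hh τ k x)
    (exp_eulerState_le hh' τ k x)).trans ?_
  refine (mul_le_mul_of_nonneg_left d1 (by positivity)).trans (le_of_eq ?_)
  ring

lemma abs_eulerObs_second_le (hα1 : α ≤ 1) {h ρ : ℝ} (hρ : 0 ≤ ρ) (hρ1 : ρ ≤ 1) (hh : |h| ≤ 1)
    (hp : |h + ρ| ≤ 1) (hm : |h - ρ| ≤ 1) (τ : ℝ≥0) (k : ℕ) (f : HolderC1 α (Rn d) ℝ) (x : Rn d) :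
    |eulerObs (driftAt b₀ b₁ (h + ρ)) (rateAt w₀ w₁ (h + ρ)) τ k f x
        + eulerObs (driftAt b₀ b₁ (h - ρ)) (rateAt w₀ w₁ (h - ρ)) τ k f x
        - 2 * eulerObs (driftAt b₀ b₁ h) (rateAt w₀ w₁ h) τ k f x|
      ≤ 12 * ‖f‖ * Real.exp (2 * coeffBound b₀ b₁ w₀ w₁ * (k * τ)) ^ 3 * ρ ^ (1 + (α : ℝ)) := by
  have hK := (coeffBound_pos b₀ b₁ w₀ w₁).le
  have H₀ := isHolderField_phaseField_zero b₀ b₁ w₀ w₁ τ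
  have H₁ := isHolderField_phaseField_one b₀ b₁ w₀ w₁ τ
  have E := fun h => isEuler_eulerState b₀ b₁ w₀ w₁ h τ x
  have du := norm_euler_sub_le H₀ H₁ hK τ.coe_nonneg hp (E (h + ρ)) (E h) rfl k
  have dv := norm_euler_sub_le H₀ H₁ hK τ.coe_nonneg hm (E (h - ρ)) (E h) rfl k
  have ds := norm_euler_second_le H₀ H₁ hK τ.coe_nonneg α.coe_nonneg (NNReal.coe_le_one.mpr hα1)
    hρ hρ1 hh hp hm (E (h + ρ)) (E (h - ρ)) (E h) rfl rfl k
  rw [add_sub_cancel_left, abs_of_nonneg hρ] at du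
  rw [sub_sub_cancel_left, abs_neg, abs_of_nonneg hρ] at dv
  have e4 : Real.exp (4 * coeffBound b₀ b₁ w₀ w₁ * (k * τ))
      = Real.exp (2 * coeffBound b₀ b₁ w₀ w₁ * (k * τ)) ^ 2 := by
    rw [← Real.exp_nat_mul]
    congr 1
    push_cast
    ring
  rw [e4] at ds
  exact abs_obs_second_le (f.isHolderField le_rfl) (norm_nonneg f) α.coe_nonneg
    (NNReal.coe_le_one.mpr hα1) (Real.one_le_exp (by positivity)) hρ hρ1
    (exp_eulerState_le hp τ k x) (exp_eulerState_le hm τ k x) (exp_eulerState_le hh τ k x) du dv ds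

variable {ν₀ : SignedMeasure (Rn d)} {ν : ℝ → ℝ≥0 → SignedMeasure (Rn d)}

lemma natCast_succ_mul_div (n : ℕ) (T : ℝ≥0) :
    ((n + 1 : ℕ) : ℝ) * ((T / (n + 1 : ℕ) : ℝ≥0) : ℝ) = T := by
  push_cast
  field_simp

lemma abs_pairing_solution_le {h : ℝ} (hh : |h| ≤ 1)
    (hν : IsWeakSolution (driftAt b₀ b₁ h) (rateAt w₀ w₁ h) ν₀ (ν h)) (T : ℝ≥0)
    (f : HolderC1 α (Rn d) ℝ) :
    |pairing (ν h T) f|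
      ≤ massBound ν₀ * (‖f‖ * Real.exp (2 * coeffBound b₀ b₁ w₀ w₁ * T)) := by
  have hc := regularCoeff_family b₀ b₁ w₀ w₁ hh
  refine le_of_tendsto (hν.tendsto_eulerObs hc T f.isC1Bounded).abs
    (Eventually.of_forall fun n => abs_pairing_le _ fun x => ?_)
  have h1 := hc.abs_eulerObs_le (T / (n + 1 : ℕ)) (n + 1) f.norm_apply_le x
  rw [natCast_succ_mul_div] at h1
  have h0 : 0 ≤ coeffBound b₀ b₁ w₀ w₁ * T :=
    mul_nonneg (coeffBound_pos b₀ b₁ w₀ w₁).le T.coe_nonneg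
  exact h1.trans (mul_le_mul_of_nonneg_left (Real.exp_le_exp.mpr (by linarith)) (norm_nonneg f))

lemma abs_pairing_solution_sub_le {h h' : ℝ} (hh : |h| ≤ 1) (hh' : |h'| ≤ 1)
    (hν : IsWeakSolution (driftAt b₀ b₁ h) (rateAt w₀ w₁ h) ν₀ (ν h))
    (hν' : IsWeakSolution (driftAt b₀ b₁ h') (rateAt w₀ w₁ h') ν₀ (ν h')) (T : ℝ≥0)
    (f : HolderC1 α (Rn d) ℝ) :
    |pairing (ν h T) f - pairing (ν h' T) f|
      ≤ massBound ν₀ *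
        (2 * ‖f‖ * Real.exp (2 * coeffBound b₀ b₁ w₀ w₁ * T) ^ 2 * |h - h'|) := by
  have hc := regularCoeff_family b₀ b₁ w₀ w₁ hh
  have hc' := regularCoeff_family b₀ b₁ w₀ w₁ hh'
  have hf := f.isHolderC1.contDiff.continuous
  refine le_of_tendsto ((hν.tendsto_eulerObs hc T f.isC1Bounded).sub
    (hν'.tendsto_eulerObs hc' T f.isC1Bounded)).abs (Eventually.of_forall fun n => ?_)
  rw [← pairing_sub _ (hc.continuous_eulerObs _ _ hf) (hc'.continuous_eulerObs _ _ hf)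
    (hc.abs_eulerObs_le _ _ f.norm_apply_le) (hc'.abs_eulerObs_le _ _ f.norm_apply_le)]
  refine abs_pairing_le _ fun x => ?_
  have h1 := abs_eulerObs_sub_le (b₀ := b₀) (b₁ := b₁) (w₀ := w₀) (w₁ := w₁) hh hh'
    (T / (n + 1 : ℕ)) (n + 1) f x
  rwa [natCast_succ_mul_div] at h1

/-- The Euler bound depends on the step only through the elapsed time, which is `T` for every `n`,
so it passes to the limit; integration against `ν₀` costs its mass bound. -/
lemma abs_pairing_solution_second_le (hα1 : α ≤ 1) {h ρ : ℝ} (hρ : 0 ≤ ρ) (hρ1 : ρ ≤ 1)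
    (hh : |h| ≤ 1) (hp : |h + ρ| ≤ 1) (hm : |h - ρ| ≤ 1)
    (hν : IsWeakSolution (driftAt b₀ b₁ h) (rateAt w₀ w₁ h) ν₀ (ν h))
    (hνp : IsWeakSolution (driftAt b₀ b₁ (h + ρ)) (rateAt w₀ w₁ (h + ρ)) ν₀ (ν (h + ρ)))
    (hνm : IsWeakSolution (driftAt b₀ b₁ (h - ρ)) (rateAt w₀ w₁ (h - ρ)) ν₀ (ν (h - ρ)))
    (T : ℝ≥0) (f : HolderC1 α (Rn d) ℝ) :
    |pairing (ν (h + ρ) T) f + pairing (ν (h - ρ) T) f - 2 * pairing (ν h T) f|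
      ≤ massBound ν₀ * (12 * ‖f‖ * Real.exp (2 * coeffBound b₀ b₁ w₀ w₁ * T) ^ 3
        * ρ ^ (1 + (α : ℝ))) := by
  have hc := regularCoeff_family b₀ b₁ w₀ w₁ hh
  have hcp := regularCoeff_family b₀ b₁ w₀ w₁ hp
  have hcm := regularCoeff_family b₀ b₁ w₀ w₁ hm
  have hf := f.isHolderC1.contDiff.continuous
  refine le_of_tendsto (((hνp.tendsto_eulerObs hcp T f.isC1Bounded).add
    (hνm.tendsto_eulerObs hcm T f.isC1Bounded)).sub
    ((hν.tendsto_eulerObs hc T f.isC1Bounded).const_mul 2)).abs (Eventually.of_forall fun n => ?_)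
  have cp := hcp.continuous_eulerObs (T / (n + 1 : ℕ)) (n + 1) hf
  have cm := hcm.continuous_eulerObs (T / (n + 1 : ℕ)) (n + 1) hf
  have c := hc.continuous_eulerObs (T / (n + 1 : ℕ)) (n + 1) hf
  have ap := hcp.abs_eulerObs_le (T / (n + 1 : ℕ)) (n + 1) f.norm_apply_le
  have am := hcm.abs_eulerObs_le (T / (n + 1 : ℕ)) (n + 1) f.norm_apply_le
  have a := hc.abs_eulerObs_le (T / (n + 1 : ℕ)) (n + 1) f.norm_apply_le
  have c' : Continuous fun x => eulerObs (driftAt b₀ b₁ (h + ρ)) (rateAt w₀ w₁ (h + ρ))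
      (T / (n + 1 : ℕ)) (n + 1) f x + eulerObs (driftAt b₀ b₁ (h - ρ)) (rateAt w₀ w₁ (h - ρ))
      (T / (n + 1 : ℕ)) (n + 1) f x := cp.add cm
  have c'' : Continuous fun x => 2 * eulerObs (driftAt b₀ b₁ h) (rateAt w₀ w₁ h)
      (T / (n + 1 : ℕ)) (n + 1) f x := continuous_const.mul c
  rw [← pairing_add _ cp cm ap am, ← pairing_const_mul, ← pairing_sub _ c' c''
    (fun x => (abs_add_le _ _).trans (add_le_add (ap x) (am x)))
    (fun x => abs_mul_le_of_le zero_le_two (a x))]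
  refine abs_pairing_le _ fun x => ?_
  have h1 := abs_eulerObs_second_le (b₀ := b₀) (b₁ := b₁) (w₀ := w₀) (w₁ := w₁) hα1 hρ hρ1 hh hp hm
    (T / (n + 1 : ℕ)) (n + 1) f x
  rwa [natCast_succ_mul_div] at h1

end Family

/-! ### Passage to the dual norm -/

section CurveInZ

variable {d : ℕ} {α : ℝ≥0}

lemma norm_spaceZ_le (z : SpaceZ d α) {C : ℝ} (hC : 0 ≤ C)
    (h : ∀ f : HolderC1 α (Rn d) ℝ, |(z : StrongDual ℝ (HolderC1 α (Rn d) ℝ)) f| ≤ C * ‖f‖) :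
    ‖z‖ ≤ C :=
  ContinuousLinearMap.opNorm_le_bound _ hC h

/-- Norm bound for the increment in time of a weak solution in `Z`. -/
lemma IsWeakSolution.exists_lipschitz_measureToZ {b : ℝ≥0 → Rn d → Rn d} {w : ℝ≥0 → Rn d → ℝ}
    {K : ℝ} {ν₀ : SignedMeasure (Rn d)} {ν : ℝ≥0 → SignedMeasure (Rn d)}
    (h : IsWeakSolution b w ν₀ ν) (hc : RegularCoeff b w K) (T : ℝ≥0) :
    ∃ C : ℝ, 0 ≤ C ∧ ∀ s t : ℝ≥0, s ≤ t → t ≤ T →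
      ‖measureToZ α (ν t) - measureToZ α (ν s)‖ ≤ C * (t - s) := by
  obtain ⟨C, hC, hlip⟩ := h.exists_lipschitz hc T
  refine ⟨C, hC, fun s t hst ht => norm_spaceZ_le _
    (mul_nonneg hC (sub_nonneg.mpr (NNReal.coe_le_coe.mpr hst))) fun f => ?_⟩
  exact (hlip s t hst ht f ‖f‖ f.isC1Bounded).trans (le_of_eq (by ring))

end CurveInZ

/-! ### Weighted curves and differentiability in the parameter -/

section WeightEmbedding

lemma continuous_of_locally_lipschitz {X : Type*} [NormedAddCommGroup X]
    {z : ℝ≥0 → X}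
    (h : ∀ T : ℝ≥0, ∃ C : ℝ, 0 ≤ C ∧ ∀ s t : ℝ≥0, s ≤ t → t ≤ T → ‖z t - z s‖ ≤ C * (t - s)) :
    Continuous z := by
  rw [continuous_iff_continuousAt]
  intro t
  obtain ⟨C, hC, hlip⟩ := h (t + 1)
  have hL : LipschitzOnWith C.toNNReal z (Set.Iic (t + 1)) := by
    refine LipschitzOnWith.of_dist_le_mul fun s hs u hu => ?_
    rw [Real.coe_toNNReal _ hC]
    wlog hsu : u ≤ s generalizing s u
    · rw [dist_comm, dist_comm s]
      exact this u hu s hs (not_le.mp hsu).le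
    rw [dist_eq_norm, NNReal.dist_eq,
      abs_of_nonneg (sub_nonneg.mpr (NNReal.coe_le_coe.mpr hsu))]
    exact hlip u s hsu hs
  exact hL.continuousOn.continuousAt (Iic_mem_nhds (lt_add_one t))

variable {X : Type*} [NormedAddCommGroup X] [NormedSpace ℝ X]

/-- Beyond time 1 the factor `1/t` is at most 1, leaving `ω = O(e^{-gt})`; on the remaining bounded
interval `ω` is bounded by assumption. -/
lemma exists_weight_bound {ω : Weight} (hω : ∀ T : ℝ≥0, BddAbove (ω '' Set.Iic T)) {g : ℝ}
    (hg : 0 < g)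
    (hO : (ω : ℝ≥0 → ℝ) =O[atTop] (fun t : ℝ≥0 => 1 / (t : ℝ) * Real.exp (-g * t))) :
    ∃ C : ℝ, 0 ≤ C ∧ ∀ t : ℝ≥0, ω t * Real.exp (g * t) ≤ C := by
  obtain ⟨c, hc⟩ := hO.bound
  obtain ⟨T, hT⟩ := eventually_atTop.mp hc
  obtain ⟨A, hA⟩ := hω (max T 1)
  have hA0 : 0 ≤ A := (ω.pos 0).le.trans (hA ⟨0, mem_Iic.mpr zero_le, rfl⟩)
  refine ⟨max |c| (A * Real.exp (g * (max T 1 : ℝ≥0))), (abs_nonneg c).trans (le_max_left _ _),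
    fun t => ?_⟩
  rcases le_total t (max T 1) with ht | ht
  · refine le_trans ?_ (le_max_right _ _)
    refine mul_le_mul (hA ⟨t, ht, rfl⟩) (Real.exp_le_exp.mpr ?_) (Real.exp_pos _).le hA0
    exact mul_le_mul_of_nonneg_left (NNReal.coe_le_coe.mpr ht) hg.le
  · refine le_trans ?_ (le_max_left _ _)
    have h1 : (1 : ℝ) ≤ t := by exact_mod_cast (le_max_right T 1).trans ht
    have h2 := hT t ((le_max_left T 1).trans ht)
    rw [Real.norm_of_nonneg (ω.pos t).le, Real.norm_of_nonneg (by positivity)] at h2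
    have h3 : 1 / (t : ℝ) * Real.exp (-g * t) ≤ 1 * Real.exp (-g * t) :=
      mul_le_mul_of_nonneg_right ((div_le_one (by linarith)).mpr h1) (Real.exp_pos _).le
    have h4 : ω t ≤ |c| * Real.exp (-g * t) := by
      refine h2.trans ((mul_le_mul_of_nonneg_right (le_abs_self c) (by positivity)).trans ?_)
      rw [one_mul] at h3
      exact mul_le_mul_of_nonneg_left h3 (abs_nonneg c)
    refine (mul_le_mul_of_nonneg_right h4 (Real.exp_pos _).le).trans (le_of_eq ?_)
    rw [mul_assoc, ← Real.exp_add]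
    simp

lemma weight_mul_norm_exp_smul_le {ω : Weight} {g C : ℝ}
    (hC : ∀ t : ℝ≥0, ω t * Real.exp (g * t) ≤ C) (u : ℝ≥0 →ᵇ X) (t : ℝ≥0) :
    ω t * ‖Real.exp (g * t) • u t‖ ≤ C * ‖u‖ := by
  rw [norm_smul, Real.norm_of_nonneg (Real.exp_pos _).le, ← mul_assoc]
  have h0 : 0 ≤ C := (mul_pos (ω.pos t) (Real.exp_pos _)).le.trans (hC t)
  exact mul_le_mul (hC t) (u.norm_coe_le_norm t) (norm_nonneg _) h0

/-- Multiplication by `e^{gt}` maps bounded continuous curves into a weighted space whose weight is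
`O(e^{-gt})`. -/
def expEmbedding (ω : Weight) (X : Type*) [NormedAddCommGroup X] [NormedSpace ℝ X] (g C : ℝ)
    (hC : ∀ t : ℝ≥0, ω t * Real.exp (g * t) ≤ C) : (ℝ≥0 →ᵇ X) →L[ℝ] WeightedC ω X :=
  LinearMap.mkContinuous
    { toFun := fun u => ⟨fun t => Real.exp (g * t) • u t,
        Continuous.smul (by fun_prop) u.continuous, ⟨C * ‖u‖, by
          rintro _ ⟨t, rfl⟩
          exact weight_mul_norm_exp_smul_le hC u t⟩⟩
      map_add' := fun u v => Subtype.ext (funext fun t => smul_add _ (u t) (v t))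
      map_smul' := fun c u => Subtype.ext (funext fun t => smul_comm _ c (u t)) }
    C (fun u => by
      rw [WeightedC.norm_def]
      exact ciSup_le fun t => weight_mul_norm_exp_smul_le hC u t)

lemma expEmbedding_apply {ω : Weight} {g C : ℝ} (hC : ∀ t : ℝ≥0, ω t * Real.exp (g * t) ≤ C)
    (u : ℝ≥0 →ᵇ X) (t : ℝ≥0) : expEmbedding ω X g C hC u t = Real.exp (g * t) • u t := rfl

/-- A curve damped by `e^{-gt}`, as a bounded continuous curve. -/
def dampedCurve (g : ℝ) (z : ℝ≥0 → X) (hcont : Continuous z) (C : ℝ)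
    (hC : ∀ t : ℝ≥0, ‖z t‖ ≤ C * Real.exp (g * t)) : ℝ≥0 →ᵇ X :=
  BoundedContinuousFunction.ofNormedAddCommGroup
    (fun t : ℝ≥0 => Real.exp (-(g * t)) • z t)
    (Continuous.smul (by fun_prop) hcont) C (fun t => by
      rw [norm_smul, Real.norm_of_nonneg (Real.exp_pos _).le]
      refine (mul_le_mul_of_nonneg_left (hC t) (Real.exp_pos _).le).trans (le_of_eq ?_)
      rw [mul_left_comm, ← Real.exp_add]
      simp)

lemma dampedCurve_apply {g C : ℝ} {z : ℝ≥0 → X} (hcont : Continuous z)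
    (hC : ∀ t : ℝ≥0, ‖z t‖ ≤ C * Real.exp (g * t)) (t : ℝ≥0) :
    dampedCurve g z hcont C hC t = Real.exp (-(g * t)) • z t := rfl

lemma norm_exp_neg_smul_le {g c : ℝ} {t : ℝ≥0} {z : X} (h : ‖z‖ ≤ c * Real.exp (g * t)) :
    ‖Real.exp (-(g * t)) • z‖ ≤ c := by
  rw [norm_smul, Real.norm_of_nonneg (Real.exp_pos _).le]
  refine (mul_le_mul_of_nonneg_left h (Real.exp_pos _).le).trans (le_of_eq ?_)
  rw [mul_left_comm, ← Real.exp_add]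
  simp

/-- Curves with exponentially bounded values, increments and second differences in a parameter
depend continuously differentiably on it in the weighted space. -/
lemma exists_contDiffOn_weighted [CompleteSpace X] {ω : Weight} {z : ℝ → ℝ≥0 → X}
    {a b g α A L B : ℝ} (hα : 0 < α) (hL : 0 ≤ L) (hB : 0 ≤ B)
    (hω : ∃ C : ℝ, 0 ≤ C ∧ ∀ t : ℝ≥0, ω t * Real.exp (g * t) ≤ C)
    (hcont : ∀ h ∈ Ioo a b, Continuous (z h))
    (hbd : ∀ h ∈ Ioo a b, ∀ t : ℝ≥0, ‖z h t‖ ≤ A * Real.exp (g * t))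
    (hlip : ∀ h ∈ Ioo a b, ∀ h' ∈ Ioo a b, ∀ t : ℝ≥0,
      ‖z h t - z h' t‖ ≤ L * |h - h'| * Real.exp (g * t))
    (hsec : ∀ x k, x - k ∈ Ioo a b → x + k ∈ Ioo a b → 0 ≤ k → ∀ t : ℝ≥0,
      ‖z (x + k) t + z (x - k) t - (2 : ℝ) • z x t‖ ≤ B * k ^ (1 + α) * Real.exp (g * t)) :
    ∃ F : ℝ → WeightedC ω X, (∀ h ∈ Ioo a b, ∀ t : ℝ≥0, F h t = z h t) ∧
      ContDiffOn ℝ 1 F (Ioo a b) := by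
  classical
  obtain ⟨C, -, hC⟩ := hω
  -- The damped curves lie in a sup-normed space that is complete because `X` is, so the
  -- second-difference criterion applies there and no completeness of the weighted space is needed.
  -- The value 0 outside the interval plays no role.
  set G : ℝ → (ℝ≥0 →ᵇ X) := fun h =>
    if hh : h ∈ Ioo a b then dampedCurve g (z h) (hcont h hh) A (hbd h hh) else 0 with hG
  have hGt : ∀ h ∈ Ioo a b, ∀ t : ℝ≥0, G h t = Real.exp (-(g * t)) • z h t := by
    intro h hh t
    simp only [hG, dif_pos hh, dampedCurve_apply]
  have hGL : LipschitzOnWith L.toNNReal G (Ioo a b) := by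
    refine LipschitzOnWith.of_dist_le_mul fun h hh h' hh' => ?_
    rw [Real.coe_toNNReal _ hL, Real.dist_eq, dist_eq_norm,
      BoundedContinuousFunction.norm_le (by positivity)]
    intro t
    rw [BoundedContinuousFunction.sub_apply, hGt h hh, hGt h' hh', ← smul_sub]
    exact norm_exp_neg_smul_le (hlip h hh h' hh' t)
  have hGd : ContDiffOn ℝ 1 G (Ioo a b) := by
    refine contDiffOn_of_second_difference (α := α) (C := B) hα hGL.continuousOn
      fun x k hm hp hk => ?_
    have hx : x ∈ Ioo a b := ⟨by linarith [hm.1], by linarith [hp.2]⟩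
    rw [BoundedContinuousFunction.norm_le (by positivity)]
    intro t
    have e : (G (x + k) + G (x - k) - (2 : ℝ) • G x) t
        = Real.exp (-(g * t)) • (z (x + k) t + z (x - k) t - (2 : ℝ) • z x t) := by
      rw [BoundedContinuousFunction.sub_apply, BoundedContinuousFunction.add_apply,
        BoundedContinuousFunction.smul_apply, hGt _ hp, hGt _ hm, hGt _ hx, smul_sub, smul_add,
        smul_comm (2 : ℝ)]
    rw [e]
    exact norm_exp_neg_smul_le (hsec x k hm hp hk t)
  refine ⟨fun h => expEmbedding ω X _ C hC (G h), fun h hh t => ?_,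
    (expEmbedding ω X _ C hC).contDiff.comp_contDiffOn hGd⟩
  rw [expEmbedding_apply, hGt h hh, smul_smul, ← Real.exp_add, add_neg_cancel, Real.exp_zero,
    one_smul]

end WeightEmbedding

/-! ### Constants for the parameter interval -/

section Parameter

lemma abs_le_one_of_mem {h : ℝ} (hh : h ∈ Ioo (-1 / 2 : ℝ) (1 / 2)) : |h| ≤ 1 :=
  abs_le.mpr ⟨by linarith [hh.1], by linarith [hh.2]⟩

lemma exp_pow_le {K t : ℝ} (hK : 0 ≤ K) (ht : 0 ≤ t) {n : ℕ} (hn : n ≤ 3) :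
    Real.exp (2 * K * t) ^ n ≤ Real.exp (6 * K * t) := by
  rw [← Real.exp_nat_mul]
  refine Real.exp_le_exp.mpr ?_
  have hn' : (n : ℝ) ≤ 3 := by exact_mod_cast hn
  nlinarith [mul_nonneg hK ht]

end Parameter

end TransportMeasures

end

/-! ### The main theorem -/

open TransportMeasures in
theorem theorem2p5 (d : ℕ) (α : ℝ≥0) (hα : 0 < α) (hα' : α ≤ 1)
    (b₀ b₁ : ℝ≥0 →ᵇ HolderC1 α (Rn d) (Rn d)) (w₀ w₁ : ℝ≥0 →ᵇ HolderC1 α (Rn d) ℝ) :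
    ∃ g : ℝ, 0 < g ∧
      ∀ ω : Weight, (∀ T : ℝ≥0, BddAbove (ω '' Set.Iic T)) →
        (ω : ℝ≥0 → ℝ) =O[atTop] (fun t : ℝ≥0 => 1 / (t : ℝ) * Real.exp (-g * t)) →
        ∀ (ν₀ : SignedMeasure (Rn d)) (ν : ℝ → ℝ≥0 → SignedMeasure (Rn d)),
          (∀ h ∈ Set.Ioo (-1 / 2 : ℝ) (1 / 2),
            IsWeakSolution (fun t x => b₀ t x + h • b₁ t x) (fun t x => w₀ t x + h * w₁ t x)
              ν₀ (ν h)) →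
          ∃ F : ℝ → WeightedC ω (SpaceZ d α),
            (∀ h ∈ Set.Ioo (-1 / 2 : ℝ) (1 / 2), ∀ t : ℝ≥0, F h t = measureToZ α (ν h t)) ∧
            ContDiffOn ℝ 1 F (Set.Ioo (-1 / 2 : ℝ) (1 / 2)) := by
  have hg : 0 < 6 * coeffBound b₀ b₁ w₀ w₁ := mul_pos (by norm_num) (coeffBound_pos b₀ b₁ w₀ w₁)
  -- Size, increments and second differences grow like `e^{2Kt}` to the powers 1, 2 and 3; the worst
  -- power gives `g = 6K`.
  refine ⟨6 * coeffBound b₀ b₁ w₀ w₁, hg, fun ω hω hO ν₀ ν hν => ?_⟩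
  have hK := (coeffBound_pos b₀ b₁ w₀ w₁).le
  have hm := massBound_nonneg ν₀
  have key : ∀ t : ℝ≥0, ∀ n ≤ 3, ∀ c : ℝ, 0 ≤ c →
      c * Real.exp (2 * coeffBound b₀ b₁ w₀ w₁ * t) ^ n
        ≤ c * Real.exp (6 * coeffBound b₀ b₁ w₀ w₁ * t) := fun t n hn c hc =>
    mul_le_mul_of_nonneg_left (exp_pow_le hK t.coe_nonneg hn) hc
  refine exists_contDiffOn_weighted (α := α) (A := massBound ν₀) (L := 2 * massBound ν₀)
    (B := 12 * massBound ν₀) (NNReal.coe_pos.mpr hα) (by positivity) (by positivity)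
    (exists_weight_bound hω hg hO) (fun h hh => ?_) (fun h hh t => ?_)
    (fun h hh h' hh' t => ?_) (fun x k hm' hp hk t => ?_)
  · exact continuous_of_locally_lipschitz ((hν h hh).exists_lipschitz_measureToZ
      (regularCoeff_family b₀ b₁ w₀ w₁ (abs_le_one_of_mem hh)))
  · refine (norm_spaceZ_le _ (by positivity) fun f => ?_).trans
      (key t 1 (by norm_num) (massBound ν₀) hm)
    refine (abs_pairing_solution_le (abs_le_one_of_mem hh) (hν h hh) t f).trans (le_of_eq ?_)
    ring
  · refine (norm_spaceZ_le _ (by positivity) fun f => ?_).trans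
      (key t 2 (by norm_num) (2 * massBound ν₀ * |h - h'|) (by positivity))
    refine (abs_pairing_solution_sub_le (abs_le_one_of_mem hh) (abs_le_one_of_mem hh') (hν h hh)
      (hν h' hh') t f).trans (le_of_eq ?_)
    ring
  · have hx : x ∈ Ioo (-1 / 2 : ℝ) (1 / 2) := ⟨by linarith [hm'.1], by linarith [hp.2]⟩
    refine (norm_spaceZ_le _ (by positivity) fun f => ?_).trans
      (key t 3 le_rfl (12 * massBound ν₀ * k ^ (1 + (α : ℝ))) (by positivity))
    -- Both `x - k` and `x + k` lie in an interval of length 1, which forces `k ≤ 1`.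
    refine (abs_pairing_solution_second_le hα' hk (by linarith [hm'.1, hp.2])
      (abs_le_one_of_mem hx) (abs_le_one_of_mem hp) (abs_le_one_of_mem hm') (hν x hx) (hν _ hp)
      (hν _ hm') t f).trans (le_of_eq ?_)
    ring
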